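/- Let $d\in\mathbb N$, let $\mathbb B^d$ be the closed unit ball of $\mathbb R^d$ and $|\cdot|$ the Euclidean norm. For $\mathbb A\subset\mathbb R$, $c_0>0$ and $r=s+v$ with $s\in\{0,1,2,\dots\}$ and $0<v\le 1$, let $Lip^{(r,c_0)}_{\mathbb A}$ be the set of $s$-times differentiable $g:\mathbb A\to\mathbb R$ with $|g^{(s)}(t)-g^{(s)}(t_0)|\le c_0|t-t_0|^v$ for all $t,t_0\in\mathbb A$, and let $Lip^{(\diamond,r,c_0)}$ be the set of radial functions $f(\mathbf x)=g(|\mathbf x|^2)$ on $\mathbb B^d$ with $g\in Lip^{(r,c_0)}_{[0,1]}$. Let $c_0>0$, $r_0=s_0+v_0$ with an integer $s_0\ge 2$ and $0<v_0\le 1$. Let $\phi\in Lip^{(r_0,c_0)}_{\mathbb R}$ be sigmoidal ($\phi(t)\to1$ and $\phi(-t)\to 0$ as $t\to\infty$), with $\|\phi\|_{L_\infty(\mathbb R)}\le1$ and $\|\phi'\|_{L_\infty(\mathbb R)}\le 1$, and let $\theta_0\in\mathbb R$ be such that $\phi^{(j)}(\theta_0)\ne0$ for $j=0,1,\dots,s_0$.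 For $A\ge1$ put $\delta_\phi(A):=\sup_{t\ge A}\max(|1-\phi(t)|,|\phi(-t)|)$. Let $r=s+v\le r_0$ with $s\in\{0,1,2,\dots\}$, $0<v\le1$, and let $f\in Lip^{(\diamond,r,c_0)}$. Then there are constants $\bar C_1,\bar C_2>0$, independent of $n$ and $A$, such that for every integer $n\ge1$ and every real $A\ge 1$ there is a deep net with tree structure and four hidden layers $$H(\mathbf x)=\sum_{j=1}^{3n+3}a_j\,\phi\Bigg(\sum_{i=1}^{s+3}a_{j,i}\,\phi\bigg(\sum_{k=1}^{6}a_{k,j,i}\,\phi\Big(\sum_{\ell=1}^{d}a_{k,\ell,j,i}\,\phi\big(w_{k,\ell,j,i}x^{(\ell)}+\theta_{k,\ell,j,i}\big)+\theta_{k,j,i}\Big)+\theta_{j,i}\bigg)+\theta_j\Bigg)$$ with $|w_{k,\ell,j,i}|\le1$, with $|\theta_{k,\ell,j,i}|,|\theta_{k,j,i}|,|\theta_{j,i}|,|\theta_j|\le 1+3An+|\theta_0|$, and with $|a_j|,|a_{j,i}|,|a_{k,j,i}|,|a_{k,\ell,j,i}|$ all bounded by $$\bar C_1\begin{cases}(An^2)^{48}\,n^{48r(r+1)(1+7(s+1)!)},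 & s_0\ge3,\ s_0>s,\\ (An^2)^{48}\,n^{48(r+1)(1+\frac7{v_0})(s+1)!}, & s_0=s\ge3,\\ (An^2)^{\frac{6v_0+42}{v_0}}\,n^{\frac{(6v_0+42)(r+1)}{v_0}\left(1+\frac{v_0+6}{v_0}(s+1)!\right)}, & s_0=2,\ s_0>s,\\ (An^2)^{\frac{6v_0+42}{v_0}}\,n^{\frac{(6v_0+42)(r+1)}{v_0}\left(1+\frac{v_0+6}{v_0^2}(s+1)!\right)}, & s_0=s=2,\end{cases}$$ such that $$\sup_{\mathbf x\in\mathbb B^d}|f(\mathbf x)-H(\mathbf x)|\le\bar C_2\,\big(n\,\delta_\phi(A)+n^{-r}\big).$$ -/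

import Mathlib

noncomputable section

/-- The class `Lip_𝔸^{(r, c₀)}` for `r = s + v`: functions that are `s` times differentiable on `𝔸`
and whose `s`-th derivative is Hölder continuous on `𝔸` with exponent `v` and constant `c₀`.
Derivatives are taken within `𝔸`; it is used for `𝔸 = ℝ` and for `𝔸 = [0, 1]`, where derivatives
within `𝔸` are unique. -/
def LipClass (𝔸 : Set ℝ) (s : ℕ) (v c₀ : ℝ) : Set (ℝ → ℝ) :=
  {g | (∀ k < s, DifferentiableOn ℝ (iteratedDerivWithin k g 𝔸) 𝔸) ∧
    ∀ t ∈ 𝔸, ∀ t₀ ∈ 𝔸,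
      |iteratedDerivWithin s g 𝔸 t - iteratedDerivWithin s g 𝔸 t₀| ≤ c₀ * |t - t₀| ^ v}

/-- The class `Lip^{(⋄, r, c₀)}`, `r = s + v`, of radial functions `x ↦ g (|x|²)` on the closed unit
ball of `ℝ^d`, with `g` in `Lip_{[0,1]}^{(r, c₀)}`. -/
def RadialLipClass (d s : ℕ) (v c₀ : ℝ) : Set (EuclideanSpace ℝ (Fin d) → ℝ) :=
  {f | ∃ g ∈ LipClass (Set.Icc 0 1) s v c₀,
    ∀ x ∈ Metric.closedBall (0 : EuclideanSpace ℝ (Fin d)) 1, f x = g (‖x‖ ^ 2)}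

/-- `φ` is sigmoidal: `φ(-t) → 0` and `φ(t) → 1` as `t → ∞`. -/
def IsSigmoidal (φ : ℝ → ℝ) : Prop :=
  Filter.Tendsto φ Filter.atBot (nhds 0) ∧ Filter.Tendsto φ Filter.atTop (nhds 1)

/-- The assumption on the activation function, with `r₀ = s₀ + v₀`: `φ` is a sigmoidal function in
`Lip_ℝ^{(r₀, c₀)}` with `‖φ‖_∞ ≤ 1` and `‖φ'‖_∞ ≤ 1`, and its derivatives of orders `0, …, s₀` do
not vanish at `θ₀`. -/
structure IsAdmissibleActivation (φ : ℝ → ℝ) (s₀ : ℕ) (v₀ c₀ θ₀ : ℝ) : Prop where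
  mem_lip : φ ∈ LipClass Set.univ s₀ v₀ c₀
  sigmoidal : IsSigmoidal φ
  abs_deriv_le_one : ∀ t, |deriv φ t| ≤ 1
  abs_le_one : ∀ t, |φ t| ≤ 1
  iteratedDeriv_ne_zero : ∀ j ≤ s₀, iteratedDeriv j φ θ₀ ≠ 0

/-- `δ_φ(A) = sup_{t ≥ A} max (|1 - φ(t)|, |φ(-t)|)`. -/
def sigmoidDelta (φ : ℝ → ℝ) (A : ℝ) : ℝ :=
  sSup ((fun t : ℝ => max |1 - φ t| |φ (-t)|) '' Set.Ici A)

/-- The free parameters of a deep net with tree structure and four hidden layers on `ℝ^d`, whose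
layers have `d`, `N₁`, `N₂`, `N₃` branches. The trailing indices `j`, `i`, `k`, `l` run over the
branches from the output layer down to the input layer. -/
structure TreeNet (d N₁ N₂ N₃ : ℕ) where
  /-- outer coefficients `a_j` -/
  a₃ : Fin N₃ → ℝ
  /-- thresholds `θ_j` -/
  θ₃ : Fin N₃ → ℝ
  /-- coefficients `a_{j,i}` -/
  a₂ : Fin N₃ → Fin N₂ → ℝ
  /-- thresholds `θ_{j,i}` -/
  θ₂ : Fin N₃ → Fin N₂ → ℝ
  /-- coefficients `a_{k,j,i}` -/
  a₁ : Fin N₃ → Fin N₂ → Fin N₁ → ℝ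
  /-- thresholds `θ_{k,j,i}` -/
  θ₁ : Fin N₃ → Fin N₂ → Fin N₁ → ℝ
  /-- coefficients `a_{k,l,j,i}` -/
  a₀ : Fin N₃ → Fin N₂ → Fin N₁ → Fin d → ℝ
  /-- thresholds `θ_{k,l,j,i}` -/
  θ₀ : Fin N₃ → Fin N₂ → Fin N₁ → Fin d → ℝ
  /-- inner weights `w_{k,l,j,i}` -/
  w : Fin N₃ → Fin N₂ → Fin N₁ → Fin d → ℝ

namespace TreeNet

variable {d N₁ N₂ N₃ : ℕ}

/-- The function computed by the net when every neuron has activation function `φ`. -/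
def eval (H : TreeNet d N₁ N₂ N₃) (φ : ℝ → ℝ) (x : EuclideanSpace ℝ (Fin d)) : ℝ :=
  ∑ j, H.a₃ j * φ (∑ i, H.a₂ j i * φ (∑ k, H.a₁ j i k * φ (∑ l, H.a₀ j i k l *
    φ (H.w j i k l * x l + H.θ₀ j i k l) + H.θ₁ j i k) + H.θ₂ j i) + H.θ₃ j)

/-- All inner weights are bounded by `W` in absolute value. -/
def WeightsLE (H : TreeNet d N₁ N₂ N₃) (W : ℝ) : Prop :=
  ∀ j i k l, |H.w j i k l| ≤ W

/-- All thresholds are bounded by `T` in absolute value. -/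
def ThresholdsLE (H : TreeNet d N₁ N₂ N₃) (T : ℝ) : Prop :=
  (∀ j, |H.θ₃ j| ≤ T) ∧ (∀ j i, |H.θ₂ j i| ≤ T) ∧ (∀ j i k, |H.θ₁ j i k| ≤ T) ∧
    ∀ j i k l, |H.θ₀ j i k l| ≤ T

/-- All coefficients are bounded by `K` in absolute value. -/
def CoeffsLE (H : TreeNet d N₁ N₂ N₃) (K : ℝ) : Prop :=
  (∀ j, |H.a₃ j| ≤ K) ∧ (∀ j i, |H.a₂ j i| ≤ K) ∧ (∀ j i k, |H.a₁ j i k| ≤ K) ∧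
    ∀ j i k l, |H.a₀ j i k l| ≤ K

end TreeNet

/-- The explicit magnitude, in terms of `A` and `n`, of the coefficients of the net, where
`r = s + v`. Since it is used for `2 ≤ s₀` and `s ≤ s₀` only, the four branches are
`3 ≤ s₀ > s`; `s₀ = s ≥ 3`; `s₀ = 2 > s`; `s₀ = s = 2`. -/
def coeffBound (s s₀ : ℕ) (v v₀ : ℝ) (n : ℕ) (A : ℝ) : ℝ :=
  let r : ℝ := s + v
  let F : ℝ := (Nat.factorial (s + 1) : ℝ)
  if 3 ≤ s₀ then
    if s < s₀ then
      (A * (n : ℝ) ^ 2) ^ 48 * (n : ℝ) ^ (48 * r * (r + 1) * (1 + 7 * F))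
    else
      (A * (n : ℝ) ^ 2) ^ 48 * (n : ℝ) ^ (48 * (r + 1) * (1 + 7 / v₀) * F)
  else
    if s < s₀ then
      (A * (n : ℝ) ^ 2) ^ ((6 * v₀ + 42) / v₀) *
        (n : ℝ) ^ ((6 * v₀ + 42) * (r + 1) / v₀ * (1 + (v₀ + 6) / v₀ * F))
    else
      (A * (n : ℝ) ^ 2) ^ ((6 * v₀ + 42) / v₀) *
        (n : ℝ) ^ ((6 * v₀ + 42) * (r + 1) / v₀ * (1 + (v₀ + 6) / v₀ ^ 2 * F))

end

/-! Write `r = s + v` and `η = n^(-(r+1))`. The first two hidden layers compute a number `τ` within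
`η / 6` of `|x|²`; the last two apply to `τ` a univariate net approximating the profile `g`.

Every arithmetic operation comes from a Taylor expansion of `φ` at `θ₀`, where the relevant
derivatives do not vanish: a first difference gives the identity, second differences give squares
and products, and a Vandermonde combination of dilates gives polynomials. With step `ε` the error is
a positive power of `ε`, and the price is a coefficient of negative power in `ε`. The gates are
`exists_identity_gate`, `exists_product_gate`, `exists_polynomial_gate` and `exists_norm_sq_gate`.

Let `P j` be the degree `s` Taylor polynomial of `g` at `j / n`. Selecting the polynomial of the
cell containing `t` amounts to the telescoping sum of `P 0` and the increments `P (j+1) - P j` with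
`(j+1) / n ≤ t`. Each indicator is replaced by a steep copy of `φ`, wrong by at most `δ_φ(A)` unless
`t` is close to the knot. At most one knot is close, and there the increment is itself `O(n^(-r))`
because both polynomials approximate `g t` (`abs_telescope_sub_le`). Indicator times increment goes
through a product gate; about `n` gates with error `O(η)` cost `O(n^(-r))` in total
(`exists_profile_net`).

The coefficients obtained are powers of `1 / η` times `A n`, far below the claimed magnitude, so
`mul_rpow_le_coeffBound` only compares exponents. -/

/-! ### Taylor's formula with Hölder remainder -/

/-- Induction on the order: the derivative of the remainder of `G 0` is the remainder of `G 1`. A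
sequence `G` of successive derivatives serves both for `φ` on a ball and for `g` within `[0, 1]`. -/
theorem abs_sub_taylor_le {S : Set ℝ} (hS : Convex ℝ S) {t₀ : ℝ} (ht₀ : t₀ ∈ S) {L β : ℝ}
    (hL : 0 ≤ L) (hβ : 0 < β) (m : ℕ) : ∀ G : ℕ → ℝ → ℝ,
    (∀ k < m, ∀ t ∈ S, HasDerivWithinAt (G k) (G (k + 1) t) S t) →
    (∀ t ∈ S, |G m t - G m t₀| ≤ L * |t - t₀| ^ β) → ∀ t ∈ S,
    |G 0 t - ∑ k ∈ Finset.range (m + 1), G k t₀ / (k.factorial : ℝ) * (t - t₀) ^ k| ≤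
      L * |t - t₀| ^ ((m : ℝ) + β) := by
  induction m with
  | zero =>
    intro G _ h2 t ht
    simpa using h2 t ht
  | succ m ih =>
    intro G h1 h2 t ht
    have key := ih (fun k => G (k + 1)) (fun k hk => h1 (k + 1) (by omega)) h2
    have hseg : segment ℝ t₀ t ⊆ S := hS.segment_subset ht₀ ht
    have hder : ∀ y ∈ segment ℝ t₀ t, HasDerivWithinAt
        (fun x => G 0 x - ∑ k ∈ Finset.range (m + 1 + 1), G k t₀ / (k.factorial : ℝ) * (x - t₀) ^ k)
        (G 1 y - ∑ k ∈ Finset.range (m + 1), G (k + 1) t₀ / (k.factorial : ℝ) * (y - t₀) ^ k)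
        (segment ℝ t₀ t) y := by
      intro y hy
      refine ((h1 0 (by omega) y (hseg hy)).mono hseg).sub ?_
      have : HasDerivAt
          (fun x => ∑ k ∈ Finset.range (m + 1 + 1), G k t₀ / (k.factorial : ℝ) * (x - t₀) ^ k)
          (∑ k ∈ Finset.range (m + 1 + 1),
            G k t₀ / (k.factorial : ℝ) * ((k : ℝ) * (y - t₀) ^ (k - 1) * 1)) y :=
        HasDerivAt.fun_sum fun k _ => (((hasDerivAt_id y).sub_const t₀).pow k).const_mul _
      rw [Finset.sum_range_succ'] at this
      refine (this.congr_deriv ?_).hasDerivWithinAt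
      simp only [Nat.cast_zero, zero_mul, mul_zero, add_zero, Nat.add_sub_cancel, mul_one]
      refine Finset.sum_congr rfl fun k _ => ?_
      rw [Nat.factorial_succ]
      push_cast
      have h3 : (k : ℝ) + 1 ≠ 0 := by positivity
      have h4 : (k.factorial : ℝ) ≠ 0 := by positivity
      field_simp
    -- The mean value inequality is used on the segment, not on `S`: there `|y - t₀| ≤ |t - t₀|`,
    -- which makes the bound on the derivative uniform.
    have hmv := (convex_segment t₀ t).norm_image_sub_le_of_norm_hasDerivWithin_le
      (C := L * |t - t₀| ^ ((m : ℝ) + β)) hder (fun y hy => by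
        refine (key y (hseg hy)).trans ?_
        have : |y - t₀| ≤ |t - t₀| := by
          rw [segment_eq_uIcc] at hy
          exact Set.abs_sub_left_of_mem_uIcc hy
        gcongr) (left_mem_segment ℝ t₀ t) (right_mem_segment ℝ t₀ t)
    have h0 : G 0 t₀ - ∑ k ∈ Finset.range (m + 1 + 1),
        G k t₀ / (k.factorial : ℝ) * (t₀ - t₀) ^ k = 0 := by
      rw [Finset.sum_range_succ']
      simp
    rw [h0, sub_zero, Real.norm_eq_abs, Real.norm_eq_abs] at hmv
    refine hmv.trans_eq ?_
    push_cast
    rw [mul_assoc, show (m : ℝ) + 1 + β = (m : ℝ) + β + 1 by ring,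
      Real.rpow_add_one' (abs_nonneg _) (by positivity)]

/-! ### Local expansion of the activation function at `θ₀` -/

namespace IsAdmissibleActivation

variable {φ : ℝ → ℝ} {s₀ : ℕ} {v₀ c₀ θ₀ : ℝ}

/-- The Hölder exponent of the `m`-th derivative of the activation function. -/
def holderExp (s₀ : ℕ) (v₀ : ℝ) (m : ℕ) : ℝ := if m < s₀ then 1 else v₀

theorem holderExp_pos (hv₀ : 0 < v₀) (m : ℕ) : 0 < holderExp s₀ v₀ m := by
  unfold holderExp; split_ifs <;> linarith

theorem holderExp_le_one (hv₀ : v₀ ≤ 1) (m : ℕ) : holderExp s₀ v₀ m ≤ 1 := by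
  unfold holderExp; split_ifs <;> linarith

theorem hasDerivAt (hφ : IsAdmissibleActivation φ s₀ v₀ c₀ θ₀) {k : ℕ} (hk : k < s₀) (t : ℝ) :
    HasDerivAt (iteratedDeriv k φ) (iteratedDeriv (k + 1) φ t) t := by
  have := hφ.mem_lip.1 k hk t (Set.mem_univ t)
  rw [iteratedDerivWithin_univ, differentiableWithinAt_univ] at this
  rw [iteratedDeriv_succ]
  exact this.hasDerivAt

theorem holder_top (hφ : IsAdmissibleActivation φ s₀ v₀ c₀ θ₀) (t t' : ℝ) :
    |iteratedDeriv s₀ φ t - iteratedDeriv s₀ φ t'| ≤ c₀ * |t - t'| ^ v₀ := by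
  simpa [iteratedDerivWithin_univ] using hφ.mem_lip.2 t (Set.mem_univ t) t' (Set.mem_univ t')

theorem exists_abs_iteratedDeriv_le (hφ : IsAdmissibleActivation φ s₀ v₀ c₀ θ₀) (hc₀ : 0 < c₀)
    (hv₀ : 0 < v₀) {k : ℕ} (hk : k ≤ s₀) (B : ℝ) :
    ∃ L, ∀ t ∈ Metric.closedBall θ₀ B, |iteratedDeriv k φ t| ≤ L := by
  rcases hk.lt_or_eq with hk | rfl
  · exact (isCompact_closedBall θ₀ B).exists_bound_of_continuousOn
      fun t _ => (hφ.hasDerivAt hk t).continuousAt.continuousWithinAt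
  · refine ⟨|iteratedDeriv k φ θ₀| + c₀ * B ^ v₀, fun t ht => ?_⟩
    have h1 := hφ.holder_top t θ₀
    have h2 : |t - θ₀| ≤ B := by simpa [Real.dist_eq] using ht
    have h3 : |t - θ₀| ^ v₀ ≤ B ^ v₀ := by gcongr
    have h4 := abs_sub_abs_le_abs_sub (iteratedDeriv k φ t) (iteratedDeriv k φ θ₀)
    nlinarith

/-- Below the top order the next derivative is bounded on the ball, so the derivative is Lipschitz
there; at the top order the Hölder hypothesis applies directly. -/
theorem exists_holder (hφ : IsAdmissibleActivation φ s₀ v₀ c₀ θ₀) (hc₀ : 0 < c₀)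
    (hv₀ : 0 < v₀) {k : ℕ} (hk : k ≤ s₀) {B : ℝ} (hB : 0 ≤ B) :
    ∃ L, 0 ≤ L ∧ ∀ t ∈ Metric.closedBall θ₀ B,
      |iteratedDeriv k φ t - iteratedDeriv k φ θ₀| ≤ L * |t - θ₀| ^ holderExp s₀ v₀ k := by
  unfold holderExp
  rcases hk.lt_or_eq with hk | rfl
  · obtain ⟨L, hL⟩ := hφ.exists_abs_iteratedDeriv_le hc₀ hv₀ (Nat.succ_le_of_lt hk) B
    have hθ : θ₀ ∈ Metric.closedBall θ₀ B := Metric.mem_closedBall_self hB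
    refine ⟨L, (abs_nonneg _).trans (hL θ₀ hθ), fun t ht => ?_⟩
    rw [if_pos hk, Real.rpow_one]
    exact (convex_closedBall θ₀ B).norm_image_sub_le_of_norm_hasDerivWithin_le
      (fun y _ => (hφ.hasDerivAt hk y).hasDerivWithinAt) hL hθ ht
  · exact ⟨c₀, hc₀.le, fun t _ => by simpa using hφ.holder_top t θ₀⟩

theorem exists_taylor (hφ : IsAdmissibleActivation φ s₀ v₀ c₀ θ₀) (hc₀ : 0 < c₀)
    (hv₀ : 0 < v₀) {m : ℕ} (hm : m ≤ s₀) {B : ℝ} (hB : 0 ≤ B) :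
    ∃ L, 0 ≤ L ∧ ∀ u, |u| ≤ B →
      |φ (u + θ₀) - ∑ k ∈ Finset.range (m + 1),
        iteratedDeriv k φ θ₀ / (k.factorial : ℝ) * u ^ k| ≤
      L * |u| ^ ((m : ℝ) + holderExp s₀ v₀ m) := by
  obtain ⟨L, hL, h⟩ := hφ.exists_holder hc₀ hv₀ hm hB
  refine ⟨L, hL, fun u hu => ?_⟩
  have := abs_sub_taylor_le (convex_closedBall θ₀ B) (Metric.mem_closedBall_self hB) hL
    (holderExp_pos hv₀ m) m (fun k => iteratedDeriv k φ)
    (fun k hk t _ => (hφ.hasDerivAt (by omega) t).hasDerivWithinAt) h (u + θ₀)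
    (by simpa [Real.dist_eq] using hu)
  simpa using this

/-! ### Gates: identity, square, product, polynomial, squared norm -/

/-- Since `s₀ ≥ 2`, the first order remainder is quadratic in `ε`; dividing by `ε φ'(θ₀)` leaves an
error linear in `ε`. -/
theorem exists_identity_gate (hφ : IsAdmissibleActivation φ s₀ v₀ c₀ θ₀) (hc₀ : 0 < c₀)
    (hv₀ : 0 < v₀) (hs₀ : 2 ≤ s₀) {B : ℝ} (hB : 0 ≤ B) :
    ∃ L, 0 ≤ L ∧ ∀ ε, 0 < ε → ε ≤ 1 → ∀ u, |u| ≤ B →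
      |(φ (ε * u + θ₀) - φ θ₀) / (ε * iteratedDeriv 1 φ θ₀) - u| ≤ L * ε := by
  obtain ⟨L, hL, h⟩ := hφ.exists_taylor hc₀ hv₀ (show 1 ≤ s₀ by omega) hB
  have h1 : iteratedDeriv 1 φ θ₀ ≠ 0 := hφ.iteratedDeriv_ne_zero 1 (by omega)
  refine ⟨L * B ^ 2 / |iteratedDeriv 1 φ θ₀|, by positivity, fun ε hε hε1 u hu => ?_⟩
  have habs : |ε * u| = ε * |u| := by rw [abs_mul, abs_of_pos hε]
  have h2 := h (ε * u) (by rw [habs]; nlinarith [abs_nonneg u])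
  rw [holderExp, if_pos (by omega : 1 < s₀), Nat.cast_one, show (1 : ℝ) + 1 = (2 : ℕ) by norm_num,
    Real.rpow_natCast, habs] at h2
  simp only [Finset.sum_range_succ, Finset.sum_range_zero, iteratedDeriv_zero, Nat.factorial,
    Nat.cast_one, pow_zero, pow_one, mul_one, div_one, zero_add] at h2
  have e : (φ (ε * u + θ₀) - φ θ₀) / (ε * iteratedDeriv 1 φ θ₀) - u =
      (φ (ε * u + θ₀) - (φ θ₀ + iteratedDeriv 1 φ θ₀ * (ε * u))) /
        (ε * iteratedDeriv 1 φ θ₀) := by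
    field_simp
    ring
  rw [e, abs_div, abs_mul, abs_of_pos hε, div_le_iff₀ (by positivity)]
  have e2 : L * B ^ 2 / |iteratedDeriv 1 φ θ₀| * ε * (ε * |iteratedDeriv 1 φ θ₀|) =
      L * (ε * B) ^ 2 := by
    field_simp
  rw [e2]
  refine h2.trans ?_
  gcongr

theorem exists_second_order (hφ : IsAdmissibleActivation φ s₀ v₀ c₀ θ₀) (hc₀ : 0 < c₀)
    (hv₀ : 0 < v₀) (hs₀ : 2 ≤ s₀) {B : ℝ} (hB : 0 ≤ B) :
    ∃ L, 0 ≤ L ∧ ∀ ε, 0 < ε → ε ≤ 1 → ∀ u, |u| ≤ B →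
      |φ (ε * u + θ₀) - (φ θ₀ + iteratedDeriv 1 φ θ₀ * (ε * u) +
        iteratedDeriv 2 φ θ₀ / 2 * (ε * u) ^ 2)| ≤ L * (ε ^ 2 * ε ^ holderExp s₀ v₀ 2) := by
  obtain ⟨L, hL, h⟩ := hφ.exists_taylor hc₀ hv₀ hs₀ hB
  have hα := holderExp_pos (s₀ := s₀) hv₀ 2
  set α := holderExp s₀ v₀ 2
  refine ⟨L * B ^ ((2 : ℕ) + α), by positivity, fun ε hε hε1 u hu => ?_⟩
  have habs : |ε * u| = ε * |u| := by rw [abs_mul, abs_of_pos hε]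
  have h2 := h (ε * u) (by rw [habs]; nlinarith [abs_nonneg u])
  simp only [Finset.sum_range_succ, Finset.sum_range_zero, iteratedDeriv_zero, Nat.factorial,
    Nat.cast_one, pow_zero, pow_one, mul_one, div_one, zero_add] at h2
  rw [habs, Real.mul_rpow hε.le (abs_nonneg u), Real.rpow_add hε, Real.rpow_natCast] at h2
  norm_num at h2 ⊢
  refine h2.trans ?_
  have : |u| ^ (2 + α) ≤ B ^ (2 + α) := by gcongr
  calc L * (ε ^ 2 * ε ^ α * |u| ^ (2 + α)) ≤ L * (ε ^ 2 * ε ^ α * B ^ (2 + α)) := by gcongr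
    _ = _ := by ring

/-- In the symmetric second difference the linear terms cancel and the quadratic term is isolated.
-/
theorem exists_square_gate (hφ : IsAdmissibleActivation φ s₀ v₀ c₀ θ₀) (hc₀ : 0 < c₀)
    (hv₀ : 0 < v₀) (hs₀ : 2 ≤ s₀) {B : ℝ} (hB : 0 ≤ B) :
    ∃ L, 0 ≤ L ∧ ∀ ε, 0 < ε → ε ≤ 1 → ∀ u, |u| ≤ B →
      |(φ (ε * u + θ₀) + φ (-ε * u + θ₀) - 2 * φ θ₀) / (ε ^ 2 * iteratedDeriv 2 φ θ₀) - u ^ 2| ≤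
        L * ε ^ holderExp s₀ v₀ 2 := by
  obtain ⟨L, hL, h⟩ := hφ.exists_second_order hc₀ hv₀ hs₀ hB
  have h1 : iteratedDeriv 2 φ θ₀ ≠ 0 := hφ.iteratedDeriv_ne_zero 2 hs₀
  refine ⟨2 * L / |iteratedDeriv 2 φ θ₀|, by positivity, fun ε hε hε1 u hu => ?_⟩
  have a1 := h ε hε hε1 u hu
  have a2 := h ε hε hε1 (-u) (by rwa [abs_neg])
  rw [show ε * -u = -ε * u by ring] at a2
  set D := iteratedDeriv 2 φ θ₀
  set E := iteratedDeriv 1 φ θ₀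
  have e : (φ (ε * u + θ₀) + φ (-ε * u + θ₀) - 2 * φ θ₀) / (ε ^ 2 * D) - u ^ 2 =
      ((φ (ε * u + θ₀) - (φ θ₀ + E * (ε * u) + D / 2 * (ε * u) ^ 2)) +
        (φ (-ε * u + θ₀) - (φ θ₀ + E * (-ε * u) + D / 2 * (-ε * u) ^ 2))) / (ε ^ 2 * D) := by
    field_simp
    ring
  rw [e, abs_div, abs_mul, abs_of_pos (pow_pos hε 2), div_le_iff₀ (by positivity)]
  refine (abs_add_le _ _).trans ((add_le_add a1 a2).trans_eq ?_)
  field_simp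
  ring

/-- Polarisation: in this mixed second difference the constant and linear terms cancel, and the
quadratic ones leave `(u + w)² - u² - w² = 2 u w`. -/
theorem exists_product_gate (hφ : IsAdmissibleActivation φ s₀ v₀ c₀ θ₀) (hc₀ : 0 < c₀)
    (hv₀ : 0 < v₀) (hs₀ : 2 ≤ s₀) {B : ℝ} (hB : 0 ≤ B) :
    ∃ L, 0 ≤ L ∧ ∀ ε, 0 < ε → ε ≤ 1 → ∀ u w, |u| ≤ B → |w| ≤ B →
      |(φ (ε * (u + w) + θ₀) - φ (ε * u + θ₀) - φ (ε * w + θ₀) + φ θ₀) /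
        (ε ^ 2 * iteratedDeriv 2 φ θ₀) - u * w| ≤ L * ε ^ holderExp s₀ v₀ 2 := by
  obtain ⟨L, hL, h⟩ := hφ.exists_second_order hc₀ hv₀ hs₀ (add_nonneg hB hB)
  have h1 : iteratedDeriv 2 φ θ₀ ≠ 0 := hφ.iteratedDeriv_ne_zero 2 hs₀
  refine ⟨3 * L / |iteratedDeriv 2 φ θ₀|, by positivity, fun ε hε hε1 u w hu hw => ?_⟩
  have a1 := h ε hε hε1 (u + w) ((abs_add_le _ _).trans (add_le_add hu hw))
  have a2 := h ε hε hε1 u (by linarith)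
  have a3 := h ε hε hε1 w (by linarith)
  set D := iteratedDeriv 2 φ θ₀
  set E := iteratedDeriv 1 φ θ₀
  set X := ε ^ 2 * ε ^ holderExp s₀ v₀ 2 with hX
  have e : (φ (ε * (u + w) + θ₀) - φ (ε * u + θ₀) - φ (ε * w + θ₀) + φ θ₀) / (ε ^ 2 * D) - u * w =
      ((φ (ε * (u + w) + θ₀) - (φ θ₀ + E * (ε * (u + w)) + D / 2 * (ε * (u + w)) ^ 2)) -
        (φ (ε * u + θ₀) - (φ θ₀ + E * (ε * u) + D / 2 * (ε * u) ^ 2)) -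
        (φ (ε * w + θ₀) - (φ θ₀ + E * (ε * w) + D / 2 * (ε * w) ^ 2))) / (ε ^ 2 * D) := by
    field_simp
    ring
  rw [e, abs_div, abs_mul, abs_of_pos (pow_pos hε 2), div_le_iff₀ (by positivity)]
  have e2 : 3 * L / |D| * ε ^ holderExp s₀ v₀ 2 * (ε ^ 2 * |D|) = 3 * (L * X) := by
    rw [hX]; field_simp
  rw [e2]
  refine (abs_sub _ _).trans ?_
  refine (add_le_add_left (abs_sub _ _) _).trans ?_
  linarith

/-- The dilates `φ (i ε τ + θ₀)`, `i = 0, …, m`, have Taylor polynomials that span degree at most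
`m`, since the Vandermonde matrix of the nodes is invertible. Coefficients of size `ε^(-m)` meet
remainders of size `ε^(m + e)`, where `e` is the Hölder exponent. The constant depends on the
polynomial only through `Q`, so it is uniform over all knots. -/
theorem exists_polynomial_gate (hφ : IsAdmissibleActivation φ s₀ v₀ c₀ θ₀) (hc₀ : 0 < c₀)
    (hv₀ : 0 < v₀) {m : ℕ} (hm : m ≤ s₀) {B Q : ℝ} (hB : 0 ≤ B) (hQ : 0 ≤ Q) :
    ∃ C, 0 ≤ C ∧ ∀ ε, 0 < ε → ε ≤ 1 → ∀ q : ℕ → ℝ, (∀ k ≤ m, |q k| ≤ Q) →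
      ∃ c : Fin (m + 1) → ℝ, (∀ i, |c i| * ε ^ m ≤ C) ∧ ∀ τ, |τ| ≤ B →
        |∑ i, c i * φ (i * ε * τ + θ₀) - ∑ k ∈ Finset.range (m + 1), q k * τ ^ k| ≤
          C * ε ^ holderExp s₀ v₀ m := by
  obtain ⟨L, hL, hT⟩ := hφ.exists_taylor hc₀ hv₀ hm (mul_nonneg (Nat.cast_nonneg m) hB)
  set e := holderExp s₀ v₀ m with he
  have he0 : 0 < e := holderExp_pos hv₀ m
  set D : ℕ → ℝ := fun k => iteratedDeriv k φ θ₀ with hD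
  have hD0 : ∀ k ≤ m, D k ≠ 0 := fun k hk => hφ.iteratedDeriv_ne_zero k (hk.trans hm)
  set V : Matrix (Fin (m + 1)) (Fin (m + 1)) ℝ :=
    (Matrix.vandermonde fun i : Fin (m + 1) => (i : ℝ)).transpose with hV
  have hdet : IsUnit V.det := by
    rw [hV, Matrix.det_transpose, isUnit_iff_ne_zero, Matrix.det_vandermonde_ne_zero_iff]
    intro i j hij
    have hij' : (i : ℝ) = j := hij
    exact Fin.ext (by exact_mod_cast hij')
  set K : Fin (m + 1) → ℝ := fun i =>
    ∑ k : Fin (m + 1), |V⁻¹ i k| * (Q * ((k : ℕ).factorial : ℝ) / |D k|) with hK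
  have hK0 : ∀ i, 0 ≤ K i := fun i => Finset.sum_nonneg fun k _ => by positivity
  set C₁ := ∑ i, K i with hC₁
  have hC₁0 : 0 ≤ C₁ := Finset.sum_nonneg fun i _ => hK0 i
  have hKC : ∀ i, K i ≤ C₁ := fun i => Finset.single_le_sum (fun i _ => hK0 i) (Finset.mem_univ i)
  set R := L * ((m : ℝ) * B) ^ ((m : ℝ) + e) with hR
  have hR0 : 0 ≤ R := by positivity
  refine ⟨C₁ + C₁ * R, by positivity, fun ε hε hε1 q hq => ?_⟩
  -- The `k`-th moment `∑ i, i^k * c i` must turn the Taylor coefficient `D k / k! * ε^k` into `q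
  -- k`.
  set b : Fin (m + 1) → ℝ := fun k => q k * ((k : ℕ).factorial : ℝ) / (D k * ε ^ (k : ℕ)) with hb
  set c := V⁻¹.mulVec b with hc
  have hVc : V.mulVec c = b := by
    rw [hc, Matrix.mulVec_mulVec, Matrix.mul_nonsing_inv _ hdet, Matrix.one_mulVec]
  have hcb : ∀ i, |c i| * ε ^ m ≤ K i := by
    intro i
    have h1 : |c i| ≤ ∑ k, |V⁻¹ i k| * |b k| := by
      simp only [hc, Matrix.mulVec, dotProduct, ← abs_mul]
      exact Finset.abs_sum_le_sum_abs _ _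
    refine (mul_le_mul_of_nonneg_right h1 (by positivity)).trans ?_
    rw [Finset.sum_mul]
    refine Finset.sum_le_sum fun k _ => ?_
    rw [mul_assoc]
    refine mul_le_mul_of_nonneg_left ?_ (abs_nonneg _)
    have hk : (k : ℕ) ≤ m := Nat.lt_succ_iff.1 k.2
    have hDk : 0 < |D k| := abs_pos.2 (hD0 k hk)
    have h2 : ε ^ m ≤ ε ^ (k : ℕ) := pow_le_pow_of_le_one hε.le hε1 hk
    have h3 : |b k| = |q k| * ((k : ℕ).factorial : ℝ) / (|D k| * ε ^ (k : ℕ)) := by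
      rw [hb]
      simp only [abs_div, abs_mul, Nat.abs_cast, abs_pow, abs_of_pos hε]
    rw [h3, div_mul_eq_mul_div, div_le_div_iff₀ (by positivity) hDk]
    have h4 := hq k hk
    calc |q k| * ((k : ℕ).factorial : ℝ) * ε ^ m * |D k|
        ≤ Q * ((k : ℕ).factorial : ℝ) * ε ^ (k : ℕ) * |D k| := by gcongr
      _ = _ := by ring
  refine ⟨c, fun i => (hcb i).trans ((hKC i).trans (le_add_of_nonneg_right (by positivity))),
    fun τ hτ => ?_⟩
  have hpoly : ∑ k ∈ Finset.range (m + 1), q k * τ ^ k =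
      ∑ i, c i * ∑ k ∈ Finset.range (m + 1), D k / (k.factorial : ℝ) * (i * ε * τ) ^ k := by
    simp only [Finset.mul_sum]
    rw [Finset.sum_comm, ← Fin.sum_univ_eq_sum_range (fun k => q k * τ ^ k),
      ← Fin.sum_univ_eq_sum_range
        (fun k => ∑ i : Fin (m + 1), c i * (D k / (k.factorial : ℝ) * (i * ε * τ) ^ k))]
    refine Finset.sum_congr rfl fun k _ => ?_
    have h1 : ∑ i : Fin (m + 1), (i : ℝ) ^ (k : ℕ) * c i = b k := by
      rw [← hVc]
      simp [Matrix.mulVec, dotProduct, hV, Matrix.vandermonde_apply]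
    have h2 : ∑ i : Fin (m + 1),
        c i * (D k / ((k : ℕ).factorial : ℝ) * (i * ε * τ) ^ (k : ℕ)) =
        D k / ((k : ℕ).factorial : ℝ) * ε ^ (k : ℕ) * τ ^ (k : ℕ) * b k := by
      rw [← h1, Finset.mul_sum]
      refine Finset.sum_congr rfl fun i _ => ?_
      ring
    have h3 := hD0 k (Nat.lt_succ_iff.1 k.2)
    rw [h2, hb]
    field_simp
  rw [hpoly, ← Finset.sum_sub_distrib]
  have hterm : ∀ i : Fin (m + 1), |c i * φ (i * ε * τ + θ₀) -
      c i * ∑ k ∈ Finset.range (m + 1), D k / (k.factorial : ℝ) * (i * ε * τ) ^ k| ≤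
      K i * (R * ε ^ e) := by
    intro i
    have hi : (i : ℝ) ≤ m := by exact_mod_cast Nat.lt_succ_iff.1 i.2
    have habs : |(i : ℝ) * ε * τ| ≤ ε * (m * B) := by
      rw [abs_mul, abs_mul, Nat.abs_cast, abs_of_pos hε]
      calc (i : ℝ) * ε * |τ| ≤ m * ε * B := by gcongr
        _ = _ := by ring
    have hmB : (0 : ℝ) ≤ m * B := by positivity
    have h1 := hT (i * ε * τ) (habs.trans (by nlinarith))
    have h2 : |(i : ℝ) * ε * τ| ^ ((m : ℝ) + e) ≤ ε ^ m * ε ^ e * (m * B) ^ ((m : ℝ) + e) := by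
      rw [← Real.rpow_natCast ε m, ← Real.rpow_add hε, ← Real.mul_rpow hε.le hmB]
      gcongr
    rw [← mul_sub, abs_mul]
    calc |c i| * _ ≤ |c i| * (L * (ε ^ m * ε ^ e * (m * B) ^ ((m : ℝ) + e))) := by
          gcongr
          exact h1.trans (by gcongr)
      _ = (|c i| * ε ^ m) * (R * ε ^ e) := by rw [hR]; ring
      _ ≤ _ := by gcongr; exact hcb i
  refine (Finset.abs_sum_le_sum_abs _ _).trans ((Finset.sum_le_sum fun i _ => hterm i).trans ?_)
  rw [← Finset.sum_mul, ← hC₁]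
  have : 0 ≤ ε ^ e := by positivity
  nlinarith

/-- The first layer forms the square gates of all coordinates at once, through the two sums with
weights `ε₁` and `-ε₁`. The second layer only has to transmit these sums, which identity gates of
step `ε₂` do. -/
theorem exists_norm_sq_gate (hφ : IsAdmissibleActivation φ s₀ v₀ c₀ θ₀) (hc₀ : 0 < c₀)
    (hv₀ : 0 < v₀) (hs₀ : 2 ≤ s₀) (d : ℕ) :
    ∃ C, 0 ≤ C ∧ ∀ η, 0 < η → η ≤ 1 → ∃ (a : Fin 6 → ℝ) (b w : Fin 6 → ℝ),
      (∀ k, |a k| * η ^ (1 + 4 / holderExp s₀ v₀ 2) ≤ C) ∧ (∀ k, |b k| ≤ 1) ∧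
      (∀ k, |w k| ≤ 1) ∧ ∀ x ∈ Metric.closedBall (0 : EuclideanSpace ℝ (Fin d)) 1,
        |∑ k, a k * φ (∑ l, b k * φ (w k * x l + θ₀) + θ₀) - ‖x‖ ^ 2| ≤ η := by
  obtain ⟨L₁, hL₁, hsq⟩ := hφ.exists_square_gate hc₀ hv₀ hs₀ zero_le_one
  obtain ⟨L₂, hL₂, hid⟩ := hφ.exists_identity_gate hc₀ hv₀ hs₀ (Nat.cast_nonneg d)
  have hα : 0 < holderExp s₀ v₀ 2 := holderExp_pos hv₀ 2
  set α := holderExp s₀ v₀ 2 with hαdef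
  have hD₁ : iteratedDeriv 1 φ θ₀ ≠ 0 := hφ.iteratedDeriv_ne_zero 1 (by omega)
  have hD₂ : iteratedDeriv 2 φ θ₀ ≠ 0 := hφ.iteratedDeriv_ne_zero 2 hs₀
  set D₁ := iteratedDeriv 1 φ θ₀
  set D₂ := iteratedDeriv 2 φ θ₀
  -- The total error for parameter `η` is at most `M η`, hence the rescaling `η₀ = M η` below.
  set M := 1 + d * L₁ + 2 * L₂ / |D₂| with hM
  have hM1 : 1 ≤ M := by
    have : 0 ≤ d * L₁ + 2 * L₂ / |D₂| := by positivity
    linarith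
  have hM0 : 0 < M := by linarith
  set p := 1 + 4 / α with hp
  set c := 1 / |D₂ * D₁| with hc
  set c' := 2 * c + 2 * d / |D₂| with hc'
  have hc0 : 0 ≤ c := by positivity
  have hdD : 0 ≤ 2 * d / |D₂| := by positivity
  refine ⟨c' * M ^ p, by positivity, fun η₀ hη₀ hη₀1 => ?_⟩
  obtain ⟨η, hη, hη1, rfl⟩ : ∃ η, 0 < η ∧ η ≤ 1 ∧ η₀ = M * η := by
    refine ⟨η₀ / M, by positivity, ?_, by field_simp⟩
    rw [div_le_one hM0]; linarith
  -- `ε₁` makes the square gate accurate to `η`. The identity error is divided by `ε₁²`, so `ε₂ =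
  -- ε₁² η` is needed; the coefficients are then of order `1 / (ε₁² ε₂) = η^(-(1 + 4/α))`.
  set ε₁ := η ^ (1 / α) with hε₁
  set ε₂ := η ^ (1 + 2 / α) with hε₂
  have hε₁0 : 0 < ε₁ := by positivity
  have hε₂0 : 0 < ε₂ := by positivity
  have hε₁1 : ε₁ ≤ 1 := Real.rpow_le_one hη.le hη1 (by positivity)
  have hε₂1 : ε₂ ≤ 1 := Real.rpow_le_one hη.le hη1 (by positivity)
  have hpow₁ : ε₁ ^ α = η := by
    rw [hε₁, ← Real.rpow_mul hη.le, one_div_mul_cancel hα.ne', Real.rpow_one]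
  have hpow₂ : ε₂ = ε₁ ^ 2 * η := by
    rw [hε₁, hε₂, ← Real.rpow_natCast, ← Real.rpow_mul hη.le, Real.rpow_add hη, Real.rpow_one,
      mul_comm]
    congr 2
    push_cast
    ring
  have hpow : ε₁ ^ 2 * ε₂ = η ^ p := by
    rw [hε₁, hε₂, ← Real.rpow_natCast, ← Real.rpow_mul hη.le, ← Real.rpow_add hη]
    congr 1
    rw [hp]
    push_cast
    ring
  have hηp : 0 < η ^ p := by positivity
  have hMp : 0 < M ^ p := by positivity
  set κ := 1 / (ε₁ ^ 2 * D₂ * (ε₂ * D₁)) with hκ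
  set μ := 2 * d / (ε₁ ^ 2 * D₂) with hμ
  have hκb : |κ| * η ^ p = c := by
    rw [hκ, ← hpow, hc, abs_div, abs_one, show ε₁ ^ 2 * D₂ * (ε₂ * D₁) = ε₁ ^ 2 * ε₂ * (D₂ * D₁) by
      ring, abs_mul, abs_of_pos (by positivity : 0 < ε₁ ^ 2 * ε₂)]
    field_simp
  have hμb : |μ| * η ^ p ≤ 2 * d / |D₂| := by
    have : |μ| * η ^ p = 2 * d / |D₂| * ε₂ := by
      rw [hμ, ← hpow, abs_div, abs_mul (ε₁ ^ 2), abs_of_pos (by positivity : 0 < ε₁ ^ 2),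
        abs_of_nonneg (by positivity : (0 : ℝ) ≤ 2 * d)]
      field_simp
    rw [this]
    nlinarith
  -- Two neurons carry the sums; the third has zero inner coefficients, outputs `φ θ₀` and supplies
  -- all constants. The other three are padding.
  refine ⟨![κ, κ, -2 * κ - μ, 0, 0, 0], ![ε₂, ε₂, 0, 0, 0, 0], ![ε₁, -ε₁, 0, 0, 0, 0],
    ?_, ?_, ?_, ?_⟩
  · have main : ∀ y, |y| ≤ 2 * |κ| + |μ| → |y| * (M * η) ^ p ≤ c' * M ^ p := by
      intro y hy
      rw [Real.mul_rpow hM0.le hη.le]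
      have : |y| * η ^ p ≤ c' := by
        calc |y| * η ^ p ≤ (2 * |κ| + |μ|) * η ^ p := by gcongr
          _ = 2 * (|κ| * η ^ p) + |μ| * η ^ p := by ring
          _ ≤ c' := by rw [hκb, hc']; linarith
      calc |y| * (M ^ p * η ^ p) = |y| * η ^ p * M ^ p := by ring
        _ ≤ _ := by gcongr
    have h1 : |κ| ≤ 2 * |κ| + |μ| := by linarith [abs_nonneg κ, abs_nonneg μ]
    have h2 : |-2 * κ - μ| ≤ 2 * |κ| + |μ| := by
      refine (abs_sub _ _).trans_eq ?_
      rw [abs_mul]; norm_num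
    have h3 : |(0 : ℝ)| ≤ 2 * |κ| + |μ| := by rw [abs_zero]; positivity
    intro k
    refine main _ ?_
    fin_cases k <;> assumption
  · have h1 : |ε₂| ≤ 1 := by rwa [abs_of_pos hε₂0]
    have h2 : |(0 : ℝ)| ≤ 1 := by simp
    intro k
    fin_cases k <;> assumption
  · have h1 : |ε₁| ≤ 1 := by rwa [abs_of_pos hε₁0]
    have h2 : |(0 : ℝ)| ≤ 1 := by simp
    have h3 : |-ε₁| ≤ 1 := by rwa [abs_neg]
    intro k
    fin_cases k <;> assumption
  · intro x hx
    have hx1 : ‖x‖ ≤ 1 := by simpa using hx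
    have hxl : ∀ l, |x l| ≤ 1 := fun l => (PiLp.norm_apply_le x l).trans hx1
    have hnorm : ‖x‖ ^ 2 = ∑ l, x l ^ 2 := by
      rw [EuclideanSpace.norm_sq_eq]; simp
    set y := ∑ l, φ (ε₁ * x l + θ₀) with hy
    set z := ∑ l, φ (-ε₁ * x l + θ₀) with hz
    have hbd : ∀ w : ℝ, |∑ l, φ (w * x l + θ₀)| ≤ d := fun w =>
      (Finset.abs_sum_le_sum_abs _ _).trans
        ((Finset.sum_le_sum fun l _ => hφ.abs_le_one _).trans (by simp))
    have hiy := hid ε₂ hε₂0 hε₂1 y (hbd _)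
    have hiz := hid ε₂ hε₂0 hε₂1 z (hbd _)
    set Y := (φ (ε₂ * y + θ₀) - φ θ₀) / (ε₂ * D₁) with hY
    set Z := (φ (ε₂ * z + θ₀) - φ θ₀) / (ε₂ * D₁) with hZ
    have hnet : ∑ k, (![κ, κ, -2 * κ - μ, 0, 0, 0] : Fin 6 → ℝ) k *
        φ (∑ l, (![ε₂, ε₂, 0, 0, 0, 0] : Fin 6 → ℝ) k *
          φ ((![ε₁, -ε₁, 0, 0, 0, 0] : Fin 6 → ℝ) k * x l + θ₀) + θ₀) =
        (Y + Z - 2 * d * φ θ₀) / (ε₁ ^ 2 * D₂) := by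
      have hz' : ∑ l, φ (-(ε₁ * x l) + θ₀) = z := by simp [hz]
      simp only [← Finset.mul_sum]
      simp [Fin.sum_univ_succ, ← hy, hz']
      rw [hY, hZ, hκ, hμ]
      field_simp
      ring
    have hsum : |(y + z - 2 * d * φ θ₀) / (ε₁ ^ 2 * D₂) - ‖x‖ ^ 2| ≤ d * (L₁ * η) := by
      have : (y + z - 2 * d * φ θ₀) / (ε₁ ^ 2 * D₂) - ‖x‖ ^ 2 =
          ∑ l, ((φ (ε₁ * x l + θ₀) + φ (-ε₁ * x l + θ₀) - 2 * φ θ₀) / (ε₁ ^ 2 * D₂) -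
            x l ^ 2) := by
        rw [Finset.sum_sub_distrib, ← Finset.sum_div, Finset.sum_sub_distrib,
          Finset.sum_add_distrib, ← hy, ← hz, ← hnorm]
        simp
        ring
      rw [this]
      refine (Finset.abs_sum_le_sum_abs _ _).trans ?_
      refine (Finset.sum_le_sum fun l _ => (hsq ε₁ hε₁0 hε₁1 (x l) (hxl l)).trans_eq
        (by rw [hpow₁])).trans_eq ?_
      simp
    have hdiff : |((Y - y) + (Z - z)) / (ε₁ ^ 2 * D₂)| ≤ 2 * L₂ / |D₂| * η := by
      rw [abs_div, abs_mul (ε₁ ^ 2), abs_of_pos (by positivity : 0 < ε₁ ^ 2),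
        div_le_iff₀ (by positivity)]
      refine (abs_add_le _ _).trans ((add_le_add hiy hiz).trans_eq ?_)
      rw [hpow₂]
      field_simp
      ring
    rw [hnet]
    have : (Y + Z - 2 * d * φ θ₀) / (ε₁ ^ 2 * D₂) - ‖x‖ ^ 2 =
        ((y + z - 2 * d * φ θ₀) / (ε₁ ^ 2 * D₂) - ‖x‖ ^ 2) +
          ((Y - y) + (Z - z)) / (ε₁ ^ 2 * D₂) := by ring
    rw [this]
    refine (abs_add_le _ _).trans ((add_le_add hsum hdiff).trans ?_)
    have : d * (L₁ * η) + 2 * L₂ / |D₂| * η + η = M * η := by rw [hM]; ring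
    linarith

end IsAdmissibleActivation

/-! ### Sigmoidal steps and the telescoping sum -/

theorem max_le_sigmoidDelta {φ : ℝ → ℝ} (h : ∀ t, |φ t| ≤ 1) {A t : ℝ} (ht : A ≤ t) :
    max |1 - φ t| |φ (-t)| ≤ sigmoidDelta φ A := by
  refine le_csSup ⟨2, ?_⟩ (Set.mem_image_of_mem _ ht)
  rintro _ ⟨u, _, rfl⟩
  have h1 := abs_le.1 (h u)
  exact max_le (abs_le.2 ⟨by linarith, by linarith⟩) ((h _).trans (by norm_num))

theorem sigmoidDelta_nonneg {φ : ℝ → ℝ} (h : ∀ t, |φ t| ≤ 1) (A : ℝ) : 0 ≤ sigmoidDelta φ A :=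
  (le_max_of_le_left (abs_nonneg _)).trans (max_le_sigmoidDelta h le_rfl)

/-- The slope `3 A n` is chosen because `1/(2n) - 1/(6n) = 1/(3n)`: the perturbed point `τ` stays on
the side of `t`, with argument of modulus at least `A`. -/
theorem abs_sub_step_le_sigmoidDelta {φ : ℝ → ℝ} (h : ∀ t, |φ t| ≤ 1) {A n : ℝ} (hA : 0 ≤ A)
    (hn : 0 < n) {t τ c : ℝ} (hτ : |τ - t| ≤ 1 / (6 * n)) (hc : 1 / (2 * n) ≤ |t - c|) :
    |φ (3 * A * n * τ - 3 * A * n * c) - if c ≤ t then 1 else 0| ≤ sigmoidDelta φ A := by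
  have h1 := abs_le.1 hτ
  have h6 : 1 / (2 * n) - 1 / (6 * n) = 1 / (3 * n) := by field_simp; norm_num
  have h3 : 3 * A * n * (1 / (3 * n)) = A := by field_simp
  have hAn : 0 ≤ 3 * A * n := by positivity
  split_ifs with hct
  · rw [abs_of_nonneg (sub_nonneg.2 hct)] at hc
    have : A ≤ 3 * A * n * τ - 3 * A * n * c := by
      have := mul_le_mul_of_nonneg_left (show 1 / (3 * n) ≤ τ - c by linarith) hAn
      linarith
    rw [abs_sub_comm]
    exact (le_max_left _ _).trans (max_le_sigmoidDelta h this)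
  · rw [abs_of_neg (sub_neg.2 (not_le.1 hct))] at hc
    have : A ≤ -(3 * A * n * τ - 3 * A * n * c) := by
      have := mul_le_mul_of_nonneg_left (show 1 / (3 * n) ≤ c - τ by linarith) hAn
      linarith
    have := (le_max_right _ _).trans (max_le_sigmoidDelta h this)
    rwa [neg_neg, ← sub_zero (φ _)] at this

/-- Exact indicators would give `P J` for the cell `J` of `t`, at distance at most `E` from `y`. Far
knots cost `2 B δ` each; the at most one near knot costs `2 * 2 E`, whence `5 E` in total. -/
theorem abs_telescope_sub_le {n : ℕ} (hn : 1 ≤ n) {t : ℝ} (ht : t ∈ Set.Icc (0 : ℝ) 1)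
    {P V : ℕ → ℝ} {y B E δ : ℝ} (hδ : 0 ≤ δ) (hB : ∀ j ≤ n, |P j| ≤ B) (hV : ∀ j < n, |V j| ≤ 1)
    (hfar : ∀ j < n, 1 / (2 * (n : ℝ)) ≤ |t - ((j + 1 : ℕ) : ℝ) / n| →
      |V j - if ((j + 1 : ℕ) : ℝ) / n ≤ t then 1 else 0| ≤ δ)
    (hP : ∀ j ≤ n, |t - (j : ℝ) / n| ≤ 2 / n → |P j - y| ≤ E) :
    |P 0 + ∑ j ∈ Finset.range n, V j * (P (j + 1) - P j) - y| ≤ 2 * B * (n * δ) + 5 * E := by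
  have hn0 : (0 : ℝ) < n := by exact_mod_cast hn
  have hnt : 0 ≤ (n : ℝ) * t := mul_nonneg hn0.le ht.1
  -- For `t = 1` this gives `J = n`, which is why `P` is needed at all `n + 1` knots.
  set J := ⌊(n : ℝ) * t⌋₊ with hJ
  have hJn : J ≤ n := by
    have : (J : ℝ) ≤ n * t := Nat.floor_le hnt
    have : (J : ℝ) ≤ n := by nlinarith [ht.2]
    exact_mod_cast this
  have hPJ : |P J - y| ≤ E := by
    refine hP J hJn ?_
    have h1 : (J : ℝ) ≤ n * t := Nat.floor_le hnt
    have h2 : (n : ℝ) * t < J + 1 := Nat.lt_floor_add_one _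
    have h3 : t - (J : ℝ) / n = (n * t - J) / n := by field_simp
    rw [h3, abs_of_nonneg (div_nonneg (by linarith) hn0.le)]
    gcongr
    linarith
  have hE : 0 ≤ E := (abs_nonneg _).trans hPJ
  have hB0 : 0 ≤ B := (abs_nonneg _).trans (hB 0 (by omega))
  have hstep : ∀ j : ℕ, ((j + 1 : ℕ) : ℝ) / n ≤ t ↔ j < J := by
    intro j
    rw [div_le_iff₀ hn0, mul_comm, ← Nat.le_floor_iff hnt, Nat.succ_le_iff]
  have htel : P J = P 0 +
      ∑ j ∈ Finset.range n, (if ((j + 1 : ℕ) : ℝ) / n ≤ t then 1 else 0) * (P (j + 1) - P j) := by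
    simp only [hstep, ite_mul, one_mul, zero_mul]
    rw [← Finset.sum_filter]
    have : (Finset.range n).filter (fun j => j < J) = Finset.range J := by
      ext j
      simp only [Finset.mem_filter, Finset.mem_range]
      omega
    rw [this, Finset.sum_range_sub]
    ring
  -- The strict inequality matters: the open intervals of radius `1/(2n)` around the knots are
  -- disjoint.
  set near : ℕ → Prop := fun j => |t - ((j + 1 : ℕ) : ℝ) / n| < 1 / (2 * (n : ℝ)) with hnear
  have hcard : ((Finset.range n).filter near).card ≤ 1 := by
    rw [Finset.card_le_one]
    intro i hi j hj
    have h1 := abs_lt.1 (Finset.mem_filter.1 hi).2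
    have h2 := abs_lt.1 (Finset.mem_filter.1 hj).2
    have h3 : 1 / (2 * (n : ℝ)) + 1 / (2 * n) = 1 / n := by field_simp; norm_num
    have h4 : ((i + 1 : ℕ) : ℝ) / n < ((j + 1 : ℕ) : ℝ) / n + 1 / n := by linarith
    have h5 : ((j + 1 : ℕ) : ℝ) / n < ((i + 1 : ℕ) : ℝ) / n + 1 / n := by linarith
    rw [← add_div, div_lt_div_iff_of_pos_right hn0] at h4 h5
    have h6 : i + 1 < j + 1 + 1 := by exact_mod_cast h4
    have h7 : j + 1 < i + 1 + 1 := by exact_mod_cast h5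
    omega
  have hterm : ∀ j ∈ Finset.range n,
      |(V j - if ((j + 1 : ℕ) : ℝ) / n ≤ t then 1 else 0) * (P (j + 1) - P j)| ≤
        δ * (2 * B) + if near j then 4 * E else 0 := by
    intro j hj
    have hj' := Finset.mem_range.1 hj
    rw [abs_mul]
    by_cases hc : near j
    · rw [if_pos hc]
      have h0 : 1 / (2 * (n : ℝ)) + 1 / n ≤ 2 / n := by
        rw [← sub_nonneg, show 2 / (n : ℝ) - (1 / (2 * n) + 1 / n) = 1 / (2 * n) by
          field_simp; norm_num]
        positivity
      have h1 : |t - ((j + 1 : ℕ) : ℝ) / n| ≤ 2 / n := by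
        have : 0 < 1 / (n : ℝ) := by positivity
        linarith
      have h2 : |t - (j : ℝ) / n| ≤ 2 / n := by
        have e : t - (j : ℝ) / n = (t - ((j + 1 : ℕ) : ℝ) / n) + 1 / n := by
          push_cast; ring
        rw [e]
        refine (abs_add_le _ _).trans ?_
        rw [abs_of_pos (by positivity : 0 < 1 / (n : ℝ))]
        linarith
      have h3 := abs_le.1 (hP (j + 1) (by omega) h1)
      have h4 := abs_le.1 (hP j (by omega) h2)
      have h5 : |P (j + 1) - P j| ≤ 2 * E := abs_le.2 ⟨by linarith, by linarith⟩
      have h6 : |V j - if ((j + 1 : ℕ) : ℝ) / n ≤ t then 1 else 0| ≤ 2 := by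
        have := abs_le.1 (hV j hj')
        split_ifs <;> exact abs_le.2 ⟨by linarith, by linarith⟩
      calc _ ≤ 2 * (2 * E) := by gcongr
        _ ≤ _ := by nlinarith
    · rw [if_neg hc, add_zero]
      have h3 := abs_le.1 (hB (j + 1) (by omega))
      have h4 := abs_le.1 (hB j (by omega))
      have h5 : |P (j + 1) - P j| ≤ 2 * B := abs_le.2 ⟨by linarith, by linarith⟩
      have h6 := hfar j hj' (not_lt.1 hc)
      gcongr
  have e : P 0 + ∑ j ∈ Finset.range n, V j * (P (j + 1) - P j) - y = (P J - y) +
      ∑ j ∈ Finset.range n,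
        (V j - if ((j + 1 : ℕ) : ℝ) / n ≤ t then 1 else 0) * (P (j + 1) - P j) := by
    simp only [sub_mul, Finset.sum_sub_distrib]
    rw [htel]
    simp only [ite_mul, one_mul, zero_mul]
    ring
  rw [e]
  refine (abs_add_le _ _).trans ?_
  have hsum : |∑ j ∈ Finset.range n,
      (V j - if ((j + 1 : ℕ) : ℝ) / n ≤ t then 1 else 0) * (P (j + 1) - P j)| ≤
      n * (δ * (2 * B)) + 4 * E := by
    refine (Finset.abs_sum_le_sum_abs _ _).trans ((Finset.sum_le_sum hterm).trans ?_)
    rw [Finset.sum_add_distrib, ← Finset.sum_filter, Finset.sum_const, Finset.sum_const,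
      Finset.card_range, nsmul_eq_mul, nsmul_eq_mul]
    have : (((Finset.range n).filter near).card : ℝ) ≤ 1 := by exact_mod_cast hcard
    nlinarith
  linarith

/-! ### Taylor polynomials of the profile -/

/-- The polynomials are expanded in powers of `t` rather than `t - t₀`, so that those at different
knots can be subtracted coefficientwise and fed to the same polynomial gate. -/
theorem exists_bounded_taylor_coeffs {g : ℝ → ℝ} {s : ℕ} {v c₀ : ℝ} (hc₀ : 0 ≤ c₀) (hv : 0 < v)
    (hg : g ∈ LipClass (Set.Icc 0 1) s v c₀) :
    ∃ (q : ℝ → ℕ → ℝ) (Q : ℝ), 0 ≤ Q ∧ (∀ t₀ ∈ Set.Icc (0 : ℝ) 1, ∀ k ≤ s, |q t₀ k| ≤ Q) ∧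
      ∀ t₀ ∈ Set.Icc (0 : ℝ) 1, ∀ t ∈ Set.Icc (0 : ℝ) 1,
        |g t - ∑ k ∈ Finset.range (s + 1), q t₀ k * t ^ k| ≤ c₀ * |t - t₀| ^ ((s : ℝ) + v) := by
  set S := Set.Icc (0 : ℝ) 1 with hS
  have hbdd : ∀ m ≤ s, ∃ G, ∀ t ∈ S, |iteratedDerivWithin m g S t| ≤ G := by
    intro m hm
    rcases hm.lt_or_eq with hm | rfl
    · exact isCompact_Icc.exists_bound_of_continuousOn (hg.1 m hm).continuousOn
    · refine ⟨|iteratedDerivWithin m g S 0| + c₀, fun t ht => ?_⟩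
      have h1 := hg.2 t ht 0 ⟨le_rfl, zero_le_one⟩
      have h2 : |t - 0| ^ v ≤ 1 := by
        rw [sub_zero, abs_of_nonneg ht.1]
        exact Real.rpow_le_one ht.1 ht.2 hv.le
      have h4 := abs_sub_abs_le_abs_sub (iteratedDerivWithin m g S t) (iteratedDerivWithin m g S 0)
      nlinarith
  choose! G hG using hbdd
  have hG0 : ∀ m ≤ s, 0 ≤ G m := fun m hm =>
    (abs_nonneg _).trans (hG m hm 0 ⟨le_rfl, zero_le_one⟩)
  refine ⟨fun t₀ k => ∑ m ∈ Finset.range (s + 1),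
    iteratedDerivWithin m g S t₀ / (m.factorial : ℝ) * ((-t₀) ^ (m - k) * (m.choose k : ℝ)),
    ∑ k ∈ Finset.range (s + 1), ∑ m ∈ Finset.range (s + 1), G m * (m.choose k : ℝ), ?_, ?_, ?_⟩
  · refine Finset.sum_nonneg fun k _ => Finset.sum_nonneg fun m hm => ?_
    have := hG0 m (Nat.lt_succ_iff.1 (Finset.mem_range.1 hm))
    positivity
  · intro t₀ ht₀ k hk
    refine le_trans ?_ (Finset.single_le_sum
      (f := fun k => ∑ m ∈ Finset.range (s + 1), G m * (m.choose k : ℝ)) (fun k _ =>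
      Finset.sum_nonneg fun m hm => ?_) (Finset.mem_range.2 (Nat.lt_succ_iff.2 hk)))
    · refine (Finset.abs_sum_le_sum_abs _ _).trans (Finset.sum_le_sum fun m hm => ?_)
      have hm' := Nat.lt_succ_iff.1 (Finset.mem_range.1 hm)
      rw [abs_mul, abs_mul, abs_div, abs_pow, abs_neg, abs_of_nonneg ht₀.1, Nat.abs_cast,
        Nat.abs_cast]
      have h1 : t₀ ^ (m - k) ≤ 1 := pow_le_one₀ ht₀.1 ht₀.2
      have h2 : |iteratedDerivWithin m g S t₀| / (m.factorial : ℝ) ≤ G m := by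
        refine (div_le_self (abs_nonneg _) ?_).trans (hG m hm' t₀ ht₀)
        exact_mod_cast Nat.one_le_iff_ne_zero.2 (Nat.factorial_ne_zero m)
      have h3 := hG0 m hm'
      have h4 : 0 ≤ t₀ ^ (m - k) := pow_nonneg ht₀.1 _
      calc _ ≤ G m * (1 * (m.choose k : ℝ)) := by gcongr
        _ = _ := by rw [one_mul]
    · have := hG0 m (Nat.lt_succ_iff.1 (Finset.mem_range.1 hm))
      positivity
  · intro t₀ ht₀ t ht
    have key := abs_sub_taylor_le (convex_Icc (0 : ℝ) 1) ht₀ hc₀ hv s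
      (fun k => iteratedDerivWithin k g S) (fun k hk t ht => by
        rw [iteratedDerivWithin_succ]
        exact (hg.1 k hk t ht).hasDerivWithinAt) (fun t ht => hg.2 t ht t₀ ht₀) t ht
    rw [iteratedDerivWithin_zero] at key
    convert key using 3
    simp only [Finset.sum_mul]
    rw [Finset.sum_comm]
    refine Finset.sum_congr rfl fun m hm => ?_
    have hm' := Nat.lt_succ_iff.1 (Finset.mem_range.1 hm)
    rw [sub_eq_add_neg, add_pow, Finset.mul_sum]
    symm
    refine (Finset.sum_subset (Finset.range_subset_range.2 (by omega)) fun k _ hk => ?_).trans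
      (Finset.sum_congr rfl fun k _ => by ring)
    rw [Nat.choose_eq_zero_of_lt (by simpa using hk)]
    simp

theorem abs_poly_sub_poly_le {s : ℕ} {q : ℕ → ℝ} {Q R x y : ℝ} (hq : ∀ k ≤ s, |q k| ≤ Q)
    (hx : |x| ≤ R) (hy : |y| ≤ R) :
    |∑ k ∈ Finset.range (s + 1), q k * x ^ k - ∑ k ∈ Finset.range (s + 1), q k * y ^ k| ≤
      Q * (∑ k ∈ Finset.range (s + 1), (k : ℝ) * R ^ (k - 1)) * |x - y| := by
  rw [← Finset.sum_sub_distrib, Finset.mul_sum, Finset.sum_mul]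
  refine (Finset.abs_sum_le_sum_abs _ _).trans (Finset.sum_le_sum fun k hk => ?_)
  rw [← mul_sub, abs_mul, mul_assoc]
  have hQ := hq k (Nat.lt_succ_iff.1 (Finset.mem_range.1 hk))
  have hQ0 := (abs_nonneg _).trans hQ
  have h := abs_pow_sub_pow_le x y k
  have hm : max |x| |y| ≤ R := max_le hx hy
  calc |q k| * |x ^ k - y ^ k| ≤ Q * (|x - y| * k * max |x| |y| ^ (k - 1)) := by gcongr
    _ ≤ Q * (|x - y| * k * R ^ (k - 1)) := by gcongr
    _ = _ := by ring

theorem abs_poly_le {s : ℕ} {q : ℕ → ℝ} {Q x : ℝ} (hq : ∀ k ≤ s, |q k| ≤ Q) (hx : |x| ≤ 1) :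
    |∑ k ∈ Finset.range (s + 1), q k * x ^ k| ≤ (s + 1) * Q := by
  refine (Finset.abs_sum_le_sum_abs _ _).trans ?_
  refine (Finset.sum_le_sum (g := fun _ => Q) fun k hk => ?_).trans (by simp)
  rw [abs_mul, abs_pow]
  have hQ := hq k (Nat.lt_succ_iff.1 (Finset.mem_range.1 hk))
  have h1 : |x| ^ k ≤ 1 := pow_le_one₀ (abs_nonneg _) hx
  have := abs_nonneg (q k)
  nlinarith [pow_nonneg (abs_nonneg x) k]

/-- A two-hidden-layer univariate net with outer thresholds `θ₀`. -/
noncomputable def biEval {ι κ : Type*} [Fintype ι] [Fintype κ] (φ : ℝ → ℝ) (θ₀ : ℝ) (a : ι → ℝ)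
    (b ω θ : ι → κ → ℝ) (τ : ℝ) : ℝ :=
  ∑ x, a x * φ (∑ y, b x y * φ (ω x y * τ + θ x y) + θ₀)

theorem biEval_comp {ι κ ι' κ' : Type*} [Fintype ι] [Fintype κ] [Fintype ι'] [Fintype κ']
    (e : ι' ≃ ι) (e' : κ' ≃ κ) (φ : ℝ → ℝ) (θ₀ : ℝ) (a : ι → ℝ) (b ω θ : ι → κ → ℝ) (τ : ℝ) :
    biEval φ θ₀ (fun x => a (e x)) (fun x y => b (e x) (e' y)) (fun x y => ω (e x) (e' y))
      (fun x y => θ (e x) (e' y)) τ = biEval φ θ₀ a b ω θ τ := by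
  unfold biEval
  rw [← e.sum_comp]
  refine Finset.sum_congr rfl fun x _ => ?_
  rw [← e'.sum_comp]

/-! ### The univariate net for the profile -/

namespace IsAdmissibleActivation

variable {φ : ℝ → ℝ} {s₀ : ℕ} {v₀ c₀ θ₀ : ℝ}

/-- Gated sums of products with approximate factors `U j ≈ p j`, `V j`, and an approximate
offset `Ub ≈ pb`. -/
theorem exists_gated_sum_bound (hφ : IsAdmissibleActivation φ s₀ v₀ c₀ θ₀) (hc₀ : 0 < c₀)
    (hv₀ : 0 < v₀) (hv₀' : v₀ ≤ 1) (hs₀ : 2 ≤ s₀) {K B : ℝ} (hK : 0 ≤ K) (hB : 0 ≤ B) :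
    ∃ C, 0 ≤ C ∧ ∀ ε η, 0 < ε → ε ≤ 1 → ε ^ holderExp s₀ v₀ 2 = η → ∀ (n : ℕ) (U V p : Fin n → ℝ)
      (Ub pb : ℝ), (∀ j, |U j - p j| ≤ K * η) → (∀ j, |p j| ≤ B) → (∀ j, |V j| ≤ 1) →
      |Ub - pb| ≤ K * η → |pb| ≤ B →
      |(∑ j, (φ (ε * (U j + V j) + θ₀) - φ (ε * U j + θ₀) - φ (ε * V j + θ₀) + φ θ₀) /
          (ε ^ 2 * iteratedDeriv 2 φ θ₀) +
        (φ (ε * Ub + θ₀) - φ θ₀) / (ε * iteratedDeriv 1 φ θ₀)) - (pb + ∑ j, V j * p j)| ≤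
      C * ((n + 1) * η) := by
  obtain ⟨L₁, hL₁, hpr⟩ := hφ.exists_product_gate hc₀ hv₀ hs₀ (B := K + B + 1) (by positivity)
  obtain ⟨L₂, hL₂, hid⟩ := hφ.exists_identity_gate hc₀ hv₀ hs₀ (B := K + B + 1) (by positivity)
  refine ⟨L₁ + L₂ + K, by positivity, fun ε η hε hε1 hη n U V p Ub pb hU hp hV hUb hpb => ?_⟩
  have hα := holderExp_pos (s₀ := s₀) hv₀ 2
  have hα1 := holderExp_le_one (s₀ := s₀) hv₀' 2
  have hη0 : 0 ≤ η := by rw [← hη]; positivity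
  have hη1 : η ≤ 1 := by rw [← hη]; exact Real.rpow_le_one hε.le hε1 hα.le
  -- Since the Hölder exponent is at most `1`, the identity gate is at least as accurate as the
  -- product gates.
  have hεη : ε ≤ η := by
    rw [← hη]
    exact Real.self_le_rpow_of_le_one hε.le hε1 hα1
  have hbound : ∀ {u p : ℝ}, |u - p| ≤ K * η → |p| ≤ B → |u| ≤ K + B + 1 := by
    intro u p h1 h2
    have h3 := abs_sub_abs_le_abs_sub u p
    nlinarith
  have hterm : ∀ j, |(φ (ε * (U j + V j) + θ₀) - φ (ε * U j + θ₀) - φ (ε * V j + θ₀) + φ θ₀) /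
      (ε ^ 2 * iteratedDeriv 2 φ θ₀) - V j * p j| ≤ (L₁ + K) * η := by
    intro j
    have h1 := hpr ε hε hε1 (U j) (V j) (hbound (hU j) (hp j)) ((hV j).trans (by linarith))
    rw [hη] at h1
    have h2 : |V j * (U j - p j)| ≤ K * η := by
      rw [abs_mul]
      nlinarith [hV j, hU j, abs_nonneg (V j), abs_nonneg (U j - p j)]
    have h3 := (abs_add_le _ _).trans (add_le_add h1 h2)
    rw [add_mul]
    refine le_of_eq_of_le ?_ h3
    congr 1
    ring
  have hbase : |(φ (ε * Ub + θ₀) - φ θ₀) / (ε * iteratedDeriv 1 φ θ₀) - pb| ≤ (L₂ + K) * η := by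
    have h1 := hid ε hε hε1 Ub (hbound hUb hpb)
    have h3 := (abs_add_le _ _).trans (add_le_add h1 hUb)
    rw [sub_add_sub_cancel] at h3
    nlinarith
  have hsum : |∑ j, ((φ (ε * (U j + V j) + θ₀) - φ (ε * U j + θ₀) - φ (ε * V j + θ₀) + φ θ₀) /
      (ε ^ 2 * iteratedDeriv 2 φ θ₀) - V j * p j)| ≤ n * ((L₁ + K) * η) := by
    refine (Finset.abs_sum_le_sum_abs _ _).trans ((Finset.sum_le_sum fun j _ => hterm j).trans ?_)
    simp
  rw [Finset.sum_sub_distrib] at hsum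
  have h := (abs_add_le _ _).trans (add_le_add hsum hbase)
  have hn : (0 : ℝ) ≤ n := Nat.cast_nonneg n
  have e : (L₁ + L₂ + K) * ((n + 1) * η) =
      n * ((L₁ + K) * η) + (L₂ + K) * η + (n * (L₂ * η) + L₁ * η) := by ring
  rw [e]
  refine le_trans (le_of_eq_of_le ?_ h) (le_add_of_nonneg_right (by positivity))
  congr 1
  ring

/-- The net with one product gate (three neurons) per increment `c j` at the knot `z j` and three
further neurons for the base term `cb` and the constants. -/
theorem exists_net_of_coeffs (hφ : IsAdmissibleActivation φ s₀ v₀ c₀ θ₀) (hs₀ : 2 ≤ s₀)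
    {n s : ℕ} (hn : 1 ≤ n) {A ε ρ K : ℝ} (hA : 1 ≤ A) (hε : 0 < ε) (hε1 : ε ≤ 1) (hρ : 0 < ρ)
    (hρ1 : ρ ≤ 1) (c : Fin n → Fin (s + 1) → ℝ) (cb : Fin (s + 1) → ℝ)
    (hc : ∀ j i, |c j i| * ρ ^ s ≤ K) (hcb : ∀ i, |cb i| * ρ ^ s ≤ K) (hK : 1 ≤ K)
    (z : Fin n → ℝ) (hz : ∀ j, z j ∈ Set.Icc (0 : ℝ) 1) :
    ∃ (a : Fin (3 * n + 3) → ℝ) (b ω θ : Fin (3 * n + 3) → Fin (s + 3) → ℝ),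
      (∀ x, |a x| * ε ^ 2 ≤
        (1 / |iteratedDeriv 2 φ θ₀| + 1 / |iteratedDeriv 1 φ θ₀|) * n) ∧
      (∀ x y, |b x y| * ρ ^ s ≤ K) ∧ (∀ x y, |ω x y| ≤ (s + 3) * (A * n)) ∧
      (∀ x y, |θ x y| ≤ 1 + 3 * A * n + |θ₀|) ∧
      ∀ τ, ∀ U V : Fin n → ℝ, (∀ j, U j = ∑ i, c j i * φ (i * ρ * τ + θ₀)) →
        (∀ j, V j = φ (3 * A * n * τ - 3 * A * n * z j)) →
        biEval φ θ₀ a b ω θ τ =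
        ∑ j, (φ (ε * (U j + V j) + θ₀) - φ (ε * U j + θ₀) - φ (ε * V j + θ₀) + φ θ₀) /
          (ε ^ 2 * iteratedDeriv 2 φ θ₀) +
        (φ (ε * (∑ i, cb i * φ (i * ρ * τ + θ₀)) + θ₀) - φ θ₀) /
          (ε * iteratedDeriv 1 φ θ₀) := by
  have hD₁ : iteratedDeriv 1 φ θ₀ ≠ 0 := hφ.iteratedDeriv_ne_zero 1 (by omega)
  have hD₂ : iteratedDeriv 2 φ θ₀ ≠ 0 := hφ.iteratedDeriv_ne_zero 2 hs₀
  set D₁ := iteratedDeriv 1 φ θ₀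
  set D₂ := iteratedDeriv 2 φ θ₀
  have hn1 : (1 : ℝ) ≤ n := by exact_mod_cast hn
  have hAn : 1 ≤ A * n := by nlinarith
  set κ := 1 / (ε ^ 2 * D₂) with hκ
  set ν := 1 / (ε * D₁) with hν
  obtain ⟨e⟩ : Nonempty (Fin (3 * n + 3) ≃ (Fin n × Fin 3) ⊕ Fin 3) :=
    ⟨Fintype.equivOfCardEq (by simp; ring)⟩
  obtain ⟨e'⟩ : Nonempty (Fin (s + 3) ≃ Fin (s + 1) ⊕ Fin 2) :=
    ⟨Fintype.equivOfCardEq (by simp)⟩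
  let P : (Fin n × Fin 3) ⊕ Fin 3 → Fin (s + 1) → ℝ := Sum.elim (fun x => c x.1) fun _ => cb
  -- A neuron receives `ε (lam U + mu V)`; the pairs `(1,1)`, `(1,0)`, `(0,1)` are the three
  -- nonconstant arguments of a product gate. The second index splits into `s + 1` polynomial
  -- neurons, one sigmoidal step and one idle neuron.
  let lam : (Fin n × Fin 3) ⊕ Fin 3 → ℝ := Sum.elim (fun x => ![1, 1, 0] x.2) ![1, 0, 0]
  let mu : (Fin n × Fin 3) ⊕ Fin 3 → ℝ := Sum.elim (fun x => ![1, 0, 1] x.2) ![0, 0, 0]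
  let Z : (Fin n × Fin 3) ⊕ Fin 3 → ℝ := Sum.elim (fun x => z x.1) fun _ => 0
  -- The constants `φ θ₀` of all `n` product gates and of the identity gate are merged into one
  -- neuron with coefficient `n κ - ν`; the last neuron is padding.
  let a : (Fin n × Fin 3) ⊕ Fin 3 → ℝ :=
    Sum.elim (fun x => ![κ, -κ, -κ] x.2) ![ν, n * κ - ν, 0]
  let b : (Fin n × Fin 3) ⊕ Fin 3 → Fin (s + 1) ⊕ Fin 2 → ℝ := fun x =>
    Sum.elim (fun i => ε * lam x * P x i) ![ε * mu x, 0]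
  let ω : (Fin n × Fin 3) ⊕ Fin 3 → Fin (s + 1) ⊕ Fin 2 → ℝ := fun _ =>
    Sum.elim (fun i => i * ρ) ![3 * A * n, 0]
  let θ : (Fin n × Fin 3) ⊕ Fin 3 → Fin (s + 1) ⊕ Fin 2 → ℝ := fun x =>
    Sum.elim (fun _ => θ₀) ![-(3 * A * n * Z x), 0]
  have hlam : ∀ x, |lam x| ≤ 1 := by
    rintro (⟨j, m⟩ | m) <;> fin_cases m <;> simp [lam]
  have hmu : ∀ x, |mu x| ≤ 1 := by
    rintro (⟨j, m⟩ | m) <;> fin_cases m <;> simp [mu]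
  have hPb : ∀ x i, |P x i| * ρ ^ s ≤ K := by
    rintro (⟨j, m⟩ | m) i
    · exact hc j i
    · exact hcb i
  have hZ : ∀ x, Z x ∈ Set.Icc (0 : ℝ) 1 := by
    rintro (⟨j, m⟩ | m)
    · exact hz j
    · exact ⟨le_rfl, zero_le_one⟩
  have ha : ∀ x, |a x| * ε ^ 2 ≤ (1 / |D₂| + 1 / |D₁|) * n := by
    have hκε : |κ| * ε ^ 2 = 1 / |D₂| := by
      rw [hκ, abs_div, abs_mul, abs_one, abs_of_pos (pow_pos hε 2)]
      field_simp
    have hνε : |ν| * ε ^ 2 ≤ 1 / |D₁| := by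
      have : |ν| * ε ^ 2 = 1 / |D₁| * ε := by
        rw [hν, abs_div, abs_mul, abs_one, abs_of_pos hε]
        field_simp
      rw [this]
      exact mul_le_of_le_one_right (by positivity) hε1
    have p₁ : 0 < 1 / |D₁| := by positivity
    have p₂ : 0 < 1 / |D₂| := by positivity
    have h1 : |κ| * ε ^ 2 ≤ (1 / |D₂| + 1 / |D₁|) * n := by nlinarith
    have h2 : |-κ| * ε ^ 2 ≤ (1 / |D₂| + 1 / |D₁|) * n := by rwa [abs_neg]
    have h3 : |ν| * ε ^ 2 ≤ (1 / |D₂| + 1 / |D₁|) * n := by nlinarith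
    have h4 : |n * κ - ν| * ε ^ 2 ≤ (1 / |D₂| + 1 / |D₁|) * n := by
      have h5 : |n * κ - ν| ≤ n * |κ| + |ν| := by
        refine (abs_sub _ _).trans_eq ?_
        rw [abs_mul, Nat.abs_cast]
      calc _ ≤ (n * |κ| + |ν|) * ε ^ 2 := by gcongr
        _ = n * (|κ| * ε ^ 2) + |ν| * ε ^ 2 := by ring
        _ ≤ _ := by rw [hκε]; nlinarith
    have h5 : |(0 : ℝ)| * ε ^ 2 ≤ (1 / |D₂| + 1 / |D₁|) * n := by
      rw [abs_zero, zero_mul]; positivity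
    rintro (⟨j, m⟩ | m) <;> fin_cases m <;> assumption
  have hb : ∀ x y, |b x y| * ρ ^ s ≤ K := by
    have hρs : ρ ^ s ≤ 1 := pow_le_one₀ hρ.le hρ1
    have hρs0 : 0 < ρ ^ s := pow_pos hρ s
    rintro x (i | m)
    · have h1 : |ε * lam x| ≤ 1 := by
        rw [abs_mul, abs_of_pos hε]
        nlinarith [hlam x, abs_nonneg (lam x)]
      change |ε * lam x * P x i| * ρ ^ s ≤ K
      rw [abs_mul, mul_assoc]
      nlinarith [hPb x i, abs_nonneg (P x i), mul_nonneg (abs_nonneg (P x i)) hρs0.le]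
    · have h1 : |ε * mu x| ≤ 1 := by
        rw [abs_mul, abs_of_pos hε]
        nlinarith [hmu x, abs_nonneg (mu x)]
      have h2 : |ε * mu x| * ρ ^ s ≤ K := by nlinarith [abs_nonneg (ε * mu x)]
      have h3 : |(0 : ℝ)| * ρ ^ s ≤ K := by rw [abs_zero, zero_mul]; linarith
      fin_cases m <;> assumption
  have hω : ∀ x y, |ω x y| ≤ (s + 3) * (A * n) := by
    rintro x (i | m)
    · change |(i : ℝ) * ρ| ≤ _
      rw [abs_mul, Nat.abs_cast, abs_of_pos hρ]
      have hi : (i : ℝ) ≤ s := by exact_mod_cast Nat.lt_succ_iff.1 i.2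
      have : (0 : ℝ) ≤ i := Nat.cast_nonneg _
      nlinarith
    · have hs : (0 : ℝ) ≤ s := Nat.cast_nonneg s
      have h1 : |3 * A * n| ≤ (s + 3) * (A * n) := by
        rw [abs_of_nonneg (by positivity)]
        nlinarith
      have h2 : |(0 : ℝ)| ≤ (s + 3) * (A * n) := by rw [abs_zero]; positivity
      fin_cases m <;> assumption
  have hθ : ∀ x y, |θ x y| ≤ 1 + 3 * A * n + |θ₀| := by
    have h0 : 0 ≤ 3 * A * n := by positivity
    rintro x (i | m)
    · change |θ₀| ≤ _
      linarith
    · have h1 : |-(3 * A * n * Z x)| ≤ 1 + 3 * A * n + |θ₀| := by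
        rw [abs_neg, abs_of_nonneg (mul_nonneg h0 (hZ x).1)]
        nlinarith [(hZ x).2, abs_nonneg θ₀]
      have h2 : |(0 : ℝ)| ≤ 1 + 3 * A * n + |θ₀| := by rw [abs_zero]; positivity
      fin_cases m <;> assumption
  refine ⟨fun x => a (e x), fun x y => b (e x) (e' y), fun x y => ω (e x) (e' y),
    fun x y => θ (e x) (e' y), fun x => ha _, fun x y => hb _ _, fun x y => hω (e x) (e' y),
    fun x y => hθ _ _, fun τ U V hU hV => ?_⟩
  rw [biEval_comp e e']
  have hinner : ∀ x, ∑ y, b x y * φ (ω x y * τ + θ x y) =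
      ε * (lam x * ∑ i, P x i * φ (i * ρ * τ + θ₀) +
        mu x * φ (3 * A * n * τ - 3 * A * n * Z x)) := by
    intro x
    rw [Fintype.sum_sum_type]
    simp only [b, ω, θ, Sum.elim_inl, Sum.elim_inr, Fin.sum_univ_two, Matrix.cons_val_zero,
      Matrix.cons_val_one, zero_mul, add_zero]
    rw [mul_add, Finset.mul_sum, Finset.mul_sum, ← sub_eq_add_neg]
    congr 1
    · exact Finset.sum_congr rfl fun i _ => by ring
    · ring
  unfold biEval
  simp only [hinner]
  rw [Fintype.sum_sum_type, Fintype.sum_prod_type]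
  simp only [a, lam, mu, P, Z, Sum.elim_inl, Sum.elim_inr, Fin.sum_univ_three,
    Matrix.cons_val_zero, Matrix.cons_val_one, Matrix.cons_val,
    zero_mul, add_zero, zero_add, one_mul, mul_zero, ← hU, ← hV]
  have hsplit : ∀ j, (φ (ε * (U j + V j) + θ₀) - φ (ε * U j + θ₀) - φ (ε * V j + θ₀) + φ θ₀) /
      (ε ^ 2 * D₂) = (κ * φ (ε * (U j + V j) + θ₀) + -κ * φ (ε * U j + θ₀) +
        -κ * φ (ε * V j + θ₀)) + κ * φ θ₀ := fun j => by rw [hκ]; ring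
  simp only [hsplit]
  simp only [Finset.sum_add_distrib, Finset.sum_const, Finset.card_univ, Fintype.card_fin,
    nsmul_eq_mul, hν]
  ring

/-- The exponent of `η` satisfies `n η = n^(-r)`, the budget for the accumulated gate errors. The
tolerance `η / 6` on `τ` is both below `1/(6n)`, as the steps require, and of order `η`, as the
Lipschitz bound on the polynomials requires. -/
theorem exists_profile_net (hφ : IsAdmissibleActivation φ s₀ v₀ c₀ θ₀) (hc₀ : 0 < c₀)
    (hv₀ : 0 < v₀) (hv₀' : v₀ ≤ 1) (hs₀ : 2 ≤ s₀) {s : ℕ} {v : ℝ} (hs : s ≤ s₀) (hv : 0 < v)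
    {g : ℝ → ℝ} (hg : g ∈ LipClass (Set.Icc 0 1) s v c₀) :
    ∃ C C₂ : ℝ, 0 < C ∧ 0 < C₂ ∧ ∀ n : ℕ, 1 ≤ n → ∀ A : ℝ, 1 ≤ A → ∀ η : ℝ,
      η = (n : ℝ) ^ (-((s : ℝ) + v + 1)) →
      ∃ (a : Fin (3 * n + 3) → ℝ) (b ω θ : Fin (3 * n + 3) → Fin (s + 3) → ℝ),
        (∀ x, |a x| * η ^ (2 / holderExp s₀ v₀ 2) ≤ C * n) ∧
        (∀ x y, |b x y| * η ^ ((s : ℝ) / holderExp s₀ v₀ s) ≤ C) ∧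
        (∀ x y, |ω x y| ≤ C * (A * n)) ∧ (∀ x y, |θ x y| ≤ 1 + 3 * A * n + |θ₀|) ∧
        ∀ t ∈ Set.Icc (0 : ℝ) 1, ∀ τ, |τ - t| ≤ η / 6 →
          |g t - biEval φ θ₀ a b ω θ τ| ≤
            C₂ * (n * sigmoidDelta φ A + (n : ℝ) ^ (-((s : ℝ) + v))) := by
  obtain ⟨q, Q, hQ, hq, hgq⟩ := exists_bounded_taylor_coeffs hc₀.le hv hg
  -- `|τ| ≤ 2` because `τ` may leave `[0, 1]` slightly; `2 * Q` bounds a difference of two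
  -- coefficients.
  obtain ⟨K, hK, hpoly⟩ := hφ.exists_polynomial_gate hc₀ hv₀ hs (B := 2) (Q := 2 * Q)
    (by norm_num) (by positivity)
  set W := 2 * Q * ∑ k ∈ Finset.range (s + 1), (k : ℝ) * 2 ^ (k - 1) with hW
  have hW0 : 0 ≤ W := mul_nonneg (by positivity) (Finset.sum_nonneg fun k _ => by positivity)
  obtain ⟨G, hG, hgate⟩ := hφ.exists_gated_sum_bound hc₀ hv₀ hv₀' hs₀ (K := K + W)
    (B := (s + 1) * (2 * Q)) (by positivity) (by positivity)
  have hα := holderExp_pos (s₀ := s₀) hv₀ 2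
  have hβ := holderExp_pos (s₀ := s₀) hv₀ s
  set α := holderExp s₀ v₀ 2
  set β := holderExp s₀ v₀ s
  have hD₁ : iteratedDeriv 1 φ θ₀ ≠ 0 := hφ.iteratedDeriv_ne_zero 1 (by omega)
  have hD₂ : iteratedDeriv 2 φ θ₀ ≠ 0 := hφ.iteratedDeriv_ne_zero 2 hs₀
  have p₁ : 0 < 1 / |iteratedDeriv 1 φ θ₀| := by positivity
  have p₂ : 0 < 1 / |iteratedDeriv 2 φ θ₀| := by positivity
  refine ⟨(1 / |iteratedDeriv 2 φ θ₀| + 1 / |iteratedDeriv 1 φ θ₀|) + (K + 1) + (s + 3),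
    2 * ((s + 1) * Q) + 5 * (c₀ * 2 ^ ((s : ℝ) + v)) + 2 * G, by positivity, by positivity,
    fun n hn A hA η hη => ?_⟩
  have hn1 : (1 : ℝ) ≤ n := by exact_mod_cast hn
  have hn0 : (0 : ℝ) < n := by linarith
  have hη0 : 0 < η := by rw [hη]; positivity
  have hη1 : η ≤ 1 := by
    rw [hη]
    exact Real.rpow_le_one_of_one_le_of_nonpos hn1 (by linarith [Nat.cast_nonneg (α := ℝ) s])
  have hηn : n * η = (n : ℝ) ^ (-((s : ℝ) + v)) := by
    rw [hη, ← Real.rpow_one_add' hn0.le (by linarith [Nat.cast_nonneg (α := ℝ) s])]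
    congr 1
    ring
  have hη_le : η ≤ 1 / n := by
    rw [hη, one_div, ← Real.rpow_neg_one]
    exact Real.rpow_le_rpow_of_exponent_le hn1 (by linarith [Nat.cast_nonneg (α := ℝ) s])
  -- Both steps are tuned so that their gates have error `O(η)`: `ε` for products, `ρ` for
  -- polynomials of degree `s`.
  set ε := η ^ (1 / α) with hε
  set ρ := η ^ (1 / β) with hρ
  have hε0 : 0 < ε := by positivity
  have hρ0 : 0 < ρ := by positivity
  have hε1 : ε ≤ 1 := Real.rpow_le_one hη0.le hη1 (by positivity)
  have hρ1 : ρ ≤ 1 := Real.rpow_le_one hη0.le hη1 (by positivity)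
  have hεα : ε ^ α = η := by
    rw [hε, ← Real.rpow_mul hη0.le, one_div_mul_cancel hα.ne', Real.rpow_one]
  have hρβ : ρ ^ β = η := by
    rw [hρ, ← Real.rpow_mul hη0.le, one_div_mul_cancel hβ.ne', Real.rpow_one]
  have hε2 : ε ^ 2 = η ^ (2 / α) := by
    rw [hε, ← Real.rpow_natCast, ← Real.rpow_mul hη0.le]
    congr 1
    push_cast
    ring
  have hρs : ρ ^ s = η ^ ((s : ℝ) / β) := by
    rw [hρ, ← Real.rpow_natCast, ← Real.rpow_mul hη0.le]
    congr 1
    ring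
  have hknot : ∀ j ≤ n, (j : ℝ) / n ∈ Set.Icc (0 : ℝ) 1 := fun j hj =>
    ⟨by positivity, by rw [div_le_one hn0]; exact_mod_cast hj⟩
  set Δ : ℕ → ℕ → ℝ := fun j k => q (((j + 1 : ℕ) : ℝ) / n) k - q ((j : ℝ) / n) k with hΔ
  have hΔb : ∀ j < n, ∀ k ≤ s, |Δ j k| ≤ 2 * Q := fun j hj k hk => by
    refine (abs_sub _ _).trans ?_
    linarith [hq _ (hknot (j + 1) hj) k hk, hq _ (hknot j hj.le) k hk]
  have hbaseb : ∀ k ≤ s, |q ((0 : ℕ) / n) k| ≤ 2 * Q := fun k hk => by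
    linarith [hq _ (hknot 0 (by omega)) k hk]
  obtain ⟨cb, hcb, hcbe⟩ := hpoly ρ hρ0 hρ1 _ hbaseb
  choose c hc hce using fun j : Fin n => hpoly ρ hρ0 hρ1 (Δ j) (hΔb j j.2)
  obtain ⟨a, b, ω, θ, ha, hb, hω, hθ, heval⟩ := hφ.exists_net_of_coeffs hs₀ hn hA hε0 hε1 hρ0 hρ1
    c cb (fun j i => (hc j i).trans (le_add_of_nonneg_right zero_le_one))
    (fun i => (hcb i).trans (le_add_of_nonneg_right zero_le_one)) (K := K + 1) (by linarith)
    (fun j => ((j + 1 : ℕ) : ℝ) / n) (fun j => hknot (j + 1) j.2)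
  have hs3 : (0 : ℝ) < s + 3 := by positivity
  refine ⟨a, b, ω, θ, fun x => ?_, fun x y => ?_, fun x y => ?_, hθ, fun t ht τ hτ => ?_⟩
  · rw [← hε2]
    exact (ha x).trans (mul_le_mul_of_nonneg_right (by linarith) hn0.le)
  · rw [← hρs]
    refine (hb x y).trans ?_
    linarith
  · exact (hω x y).trans (mul_le_mul_of_nonneg_right (by linarith) (by positivity))
  · have ht1 : |t| ≤ 1 := by rw [abs_of_nonneg ht.1]; exact ht.2
    have hτ2 : |τ| ≤ 2 := by
      have := abs_sub_abs_le_abs_sub τ t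
      linarith
    have ht2 : |t| ≤ 2 := by linarith
    set P : ℕ → ℝ := fun j => ∑ k ∈ Finset.range (s + 1), q ((j : ℝ) / n) k * t ^ k with hP
    have happrox : ∀ (coef : ℕ → ℝ) (y : ℝ), (∀ k ≤ s, |coef k| ≤ 2 * Q) →
        |y - ∑ k ∈ Finset.range (s + 1), coef k * τ ^ k| ≤ K * ρ ^ β →
        |y - ∑ k ∈ Finset.range (s + 1), coef k * t ^ k| ≤ (K + W) * η := by
      intro coef y h1 h2
      have h3 := abs_poly_sub_poly_le h1 hτ2 ht2
      have h4 := (abs_add_le _ _).trans (add_le_add h2 h3)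
      rw [sub_add_sub_cancel, hρβ, ← hW] at h4
      refine h4.trans ?_
      have h5 : W * |τ - t| ≤ W * η := by gcongr; linarith
      linarith
    have hsub : ∀ j, ∑ k ∈ Finset.range (s + 1), Δ j k * t ^ k = P (j + 1) - P j := fun j => by
      simp only [hΔ, hP, sub_mul, Finset.sum_sub_distrib]
    set V : ℕ → ℝ := fun j => φ (3 * A * n * τ - 3 * A * n * (((j + 1 : ℕ) : ℝ) / n)) with hV
    have h1 := hgate ε η hε0 hε1 hεα n (fun j => ∑ i, c j i * φ (i * ρ * τ + θ₀))
      (fun j => V j) (fun j => P (j + 1) - P j) (∑ i, cb i * φ (i * ρ * τ + θ₀)) (P 0)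
      (fun j => by rw [← hsub]; exact happrox _ _ (hΔb j j.2) (hce j τ hτ2))
      (fun j => by rw [← hsub]; exact abs_poly_le (hΔb j j.2) ht1)
      (fun j => hφ.abs_le_one _) (happrox _ _ hbaseb (hcbe τ hτ2)) (abs_poly_le hbaseb ht1)
    rw [← heval τ _ _ (fun j => rfl) (fun j => rfl),
      Fin.sum_univ_eq_sum_range (fun j => V j * (P (j + 1) - P j))] at h1
    have hδ := sigmoidDelta_nonneg hφ.abs_le_one A
    have h2 := abs_telescope_sub_le hn ht (P := P) (V := V) (y := g t) (B := (s + 1) * Q)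
      (E := c₀ * 2 ^ ((s : ℝ) + v) * (n : ℝ) ^ (-((s : ℝ) + v))) hδ
      (fun j hj => abs_poly_le (hq _ (hknot j hj)) ht1) (fun j _ => hφ.abs_le_one _)
      (fun j hj hfar => abs_sub_step_le_sigmoidDelta hφ.abs_le_one (by linarith) hn0
        (hτ.trans (by rw [mul_comm, ← div_div]; gcongr)) hfar)
      (fun j hj hnear => by
        rw [abs_sub_comm]
        refine (hgq _ (hknot j hj) t ht).trans ?_
        rw [mul_assoc, Real.rpow_neg hn0.le, ← div_eq_mul_inv,
          ← Real.div_rpow (by norm_num) hn0.le]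
        gcongr)
    have h3 := abs_sub_le (biEval φ θ₀ a b ω θ τ)
      (P 0 + ∑ j ∈ Finset.range n, V j * (P (j + 1) - P j)) (g t)
    rw [abs_sub_comm]
    refine h3.trans ((add_le_add h1 h2).trans ?_)
    rw [← hηn]
    have h4 : 0 ≤ G * η := by positivity
    have h5 : 0 ≤ c₀ * 2 ^ ((s : ℝ) + v) := by positivity
    have h6 : (n + 1) * η ≤ 2 * (n * η) := by nlinarith
    have h7 : G * ((n + 1) * η) ≤ G * (2 * (n * η)) := by gcongr
    have h8 : 0 ≤ (5 * (c₀ * 2 ^ ((s : ℝ) + v)) + 2 * G) * (n * sigmoidDelta φ A) := by positivity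
    have h9 : 0 ≤ 2 * ((s + 1) * Q) * (n * η) := by positivity
    linarith

end IsAdmissibleActivation

/-! ### Comparison of the coefficient magnitudes -/

theorem mul_rpow_le_of_exponent_le {A n E F p : ℝ} (hA : 1 ≤ A) (hn : 1 ≤ n) (hE : 1 ≤ E)
    (hp : p ≤ 2 * (E - 1) + F) : A * n * n ^ p ≤ (A * n ^ 2) ^ E * n ^ F := by
  have hn0 : 0 < n := by linarith
  have hA0 : 0 < A := by linarith
  have h1 : A ≤ A ^ E := Real.self_le_rpow_of_one_le hA hE
  have h2 : n * n ^ p ≤ n ^ (2 * E + F) := by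
    rw [mul_comm, ← Real.rpow_add_one hn0.ne']
    exact Real.rpow_le_rpow_of_exponent_le hn (by linarith)
  rw [Real.mul_rpow hA0.le (by positivity), ← Real.rpow_natCast n 2, ← Real.rpow_mul hn0.le,
    mul_assoc, mul_assoc, ← Real.rpow_add hn0]
  push_cast
  gcongr

-- The two alternatives for `p` are the costs of the squared norm gate and of the polynomial gate.
-- Each branch reduces to a polynomial inequality between exponents, using `s + 1 ≤ (s + 1)!`.
open IsAdmissibleActivation in
theorem mul_rpow_le_coeffBound {s s₀ n : ℕ} {v v₀ A p : ℝ} (hs₀ : 2 ≤ s₀) (hs : s ≤ s₀)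
    (hv₀ : 0 < v₀) (hv₀' : v₀ ≤ 1) (hv : 0 < v) (hn : 1 ≤ n) (hA : 1 ≤ A)
    (hp : p ≤ ((s : ℝ) + v + 1) * (1 + 4 / holderExp s₀ v₀ 2) ∨
      p ≤ ((s : ℝ) + v + 1) * (s / holderExp s₀ v₀ s)) :
    A * n * (n : ℝ) ^ p ≤ coeffBound s s₀ v v₀ n A := by
  have hn1 : (1 : ℝ) ≤ n := by exact_mod_cast hn
  have hs' : (0 : ℝ) ≤ s := Nat.cast_nonneg s
  have hF : (s : ℝ) + 1 ≤ ((s + 1).factorial : ℝ) := by exact_mod_cast Nat.self_le_factorial (s + 1)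
  -- Replacing `v₀` by its inverse `w ≥ 1` makes all exponents polynomial.
  obtain ⟨w, hw, rfl⟩ : ∃ w, 1 ≤ w ∧ v₀ = 1 / w :=
    ⟨1 / v₀, (one_le_div hv₀).2 hv₀', by simp⟩
  have hw0 : 0 < w := by linarith
  unfold coeffBound
  simp only
  set F := ((s + 1).factorial : ℝ)
  set r := (s : ℝ) + v with hr
  have hr0 : 0 < r := by linarith
  have hsr : (s : ℝ) ≤ r := by linarith
  have hE : (6 * (1 / w) + 42) / (1 / w) = 6 + 42 * w := by field_simp
  have e1 : (6 * (1 / w) + 42) * (r + 1) / (1 / w) = (6 + 42 * w) * (r + 1) := by field_simp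
  have e2 : (1 / w + 6) / (1 / w) = 1 + 6 * w := by field_simp
  have e3 : (1 / w + 6) / (1 / w) ^ 2 = w + 6 * w ^ 2 := by field_simp
  have hF0 : 1 ≤ F := by linarith
  have hrF : 0 ≤ (r + 1) * (F - 1) := mul_nonneg (by linarith) (by linarith)
  unfold holderExp at hp
  split_ifs with h3 hlt hlt
  · rw [if_pos (by omega), if_pos hlt] at hp
    rw [← Real.rpow_natCast]
    refine mul_rpow_le_of_exponent_le hA hn1 (by norm_num) ?_
    have h1 : r * (r + 1) * 1 ≤ r * (r + 1) * F := by gcongr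
    push_cast
    rcases hp with hp | hp <;> nlinarith
  · rw [if_pos (by omega), if_neg hlt] at hp
    rw [← Real.rpow_natCast]
    refine mul_rpow_le_of_exponent_le hA hn1 (by norm_num) ?_
    rw [div_div_eq_mul_div, div_one] at *
    have h1 : (r + 1) * 1 ≤ (r + 1) * F := by gcongr
    have h2 : (r + 1) * w * s ≤ (r + 1) * w * F := by gcongr; linarith
    have h4 : 0 ≤ (r + 1) * w * F := by positivity
    push_cast
    rcases hp with hp | hp
    · nlinarith
    · have : (r + 1) * (s / (1 / w)) = (r + 1) * w * s := by field_simp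
      nlinarith
  · rw [if_neg (by omega), if_pos hlt] at hp
    rw [hE, e1, e2]
    refine mul_rpow_le_of_exponent_le hA hn1 (by linarith) ?_
    have hs1 : (s : ℝ) ≤ 1 := by exact_mod_cast (by omega : s ≤ 1)
    have h0 : 0 ≤ (6 + 42 * w) * (r + 1) * ((1 + 6 * w) * F) := by positivity
    have h2 : (r + 1) * 1 ≤ (r + 1) * w := by gcongr
    rcases hp with hp | hp
    · have : (r + 1) * (1 + 4 / (1 / w)) = (r + 1) + 4 * ((r + 1) * w) := by field_simp
      nlinarith
    · have : (r + 1) * (s / 1) ≤ (r + 1) * 1 := by rw [div_one]; gcongr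
      nlinarith
  · rw [if_neg (by omega), if_neg hlt] at hp
    rw [hE, e1, e3]
    refine mul_rpow_le_of_exponent_le hA hn1 (by linarith) ?_
    have hs1 : (s : ℝ) ≤ 2 := by exact_mod_cast (by omega : s ≤ 2)
    have h0 : 0 ≤ (6 + 42 * w) * (r + 1) * ((w + 6 * w ^ 2) * F) := by positivity
    have h2 : (r + 1) * 1 ≤ (r + 1) * w := by gcongr
    rcases hp with hp | hp
    · have : (r + 1) * (1 + 4 / (1 / w)) = (r + 1) + 4 * ((r + 1) * w) := by field_simp
      nlinarith
    · have : (r + 1) * (s / (1 / w)) = (r + 1) * w * s := by field_simp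
      have : (r + 1) * w * s ≤ (r + 1) * w * 2 := by gcongr
      nlinarith

/-! ### Assembly of the four layers -/

/-- The tree has no free weight between `τ` and the third layer, so every branch carries its own
copy of the norm gate and `ω` is absorbed into its coefficients. This product is the source of the
factor `A n`. -/
theorem TreeNet.eval_eq_biEval {d N₁ N₂ N₃ : ℕ} (φ : ℝ → ℝ) (θ₀ : ℝ) (a : Fin N₃ → ℝ)
    (b ω θ : Fin N₃ → Fin N₂ → ℝ) (α β γ : Fin N₁ → ℝ) (x : EuclideanSpace ℝ (Fin d)) :
    TreeNet.eval
      { a₃ := a, θ₃ := fun _ => θ₀, a₂ := b, θ₂ := θ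
        a₁ := fun j i k => ω j i * α k, θ₁ := fun _ _ _ => θ₀
        a₀ := fun _ _ k _ => β k, θ₀ := fun _ _ _ _ => θ₀, w := fun _ _ k _ => γ k } φ x =
      biEval φ θ₀ a b ω θ (∑ k, α k * φ (∑ l, β k * φ (γ k * x l + θ₀) + θ₀)) := by
  simp only [TreeNet.eval, biEval, mul_assoc, ← Finset.mul_sum]

theorem abs_le_mul_of_mul_rpow_le {y η p C Y X : ℝ} (hη : 0 < η) (hC : 0 ≤ C)
    (h : |y| * η ^ p ≤ C * Y) (hX : Y * η ^ (-p) ≤ X) : |y| ≤ C * X := by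
  have hp : 0 < η ^ p := by positivity
  calc |y| = |y| * η ^ p * η ^ (-p) := by rw [Real.rpow_neg hη.le]; field_simp
    _ ≤ C * Y * η ^ (-p) := by gcongr
    _ = C * (Y * η ^ (-p)) := by ring
    _ ≤ C * X := by gcongr

theorem theorem5 (d s s₀ : ℕ) (v v₀ c₀ θ₀ : ℝ) (φ : ℝ → ℝ)
    (hc₀ : 0 < c₀) (hs₀ : 2 ≤ s₀) (hv₀ : 0 < v₀) (hv₀' : v₀ ≤ 1)
    (hφ : IsAdmissibleActivation φ s₀ v₀ c₀ θ₀)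
    (hv : 0 < v) (hv' : v ≤ 1) (hr : (s : ℝ) + v ≤ (s₀ : ℝ) + v₀)
    (f : EuclideanSpace ℝ (Fin d) → ℝ) (hf : f ∈ RadialLipClass d s v c₀) :
    ∃ C₁ C₂ : ℝ, 0 < C₁ ∧ 0 < C₂ ∧ ∀ n : ℕ, 1 ≤ n → ∀ A : ℝ, 1 ≤ A →
      ∃ H : TreeNet d 6 (s + 3) (3 * n + 3),
        H.WeightsLE 1 ∧
        H.ThresholdsLE (1 + 3 * A * n + |θ₀|) ∧
        H.CoeffsLE (C₁ * coeffBound s s₀ v v₀ n A) ∧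
        ∀ x ∈ Metric.closedBall (0 : EuclideanSpace ℝ (Fin d)) 1,
          |f x - H.eval φ x| ≤
            C₂ * (n * sigmoidDelta φ A + (n : ℝ) ^ (-((s : ℝ) + v))) := by
  have hs : s ≤ s₀ := by
    have : (s : ℝ) < (s₀ + 1 : ℕ) := by push_cast; linarith
    exact Nat.lt_succ_iff.1 (by exact_mod_cast this)
  obtain ⟨g, hg, hfg⟩ := hf
  obtain ⟨K, hK, hsq⟩ := hφ.exists_norm_sq_gate hc₀ hv₀ hs₀ d
  obtain ⟨C, C₂, hC, hC₂, hnet⟩ := hφ.exists_profile_net hc₀ hv₀ hv₀' hs₀ hs hv hg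
  have hcoeff := fun (n : ℕ) (A p : ℝ) (hn : 1 ≤ n) (hA : 1 ≤ A) =>
    mul_rpow_le_coeffBound (p := p) hs₀ hs hv₀ hv₀' hv hn hA
  have hα := IsAdmissibleActivation.holderExp_pos (s₀ := s₀) hv₀ 2
  have hβ := IsAdmissibleActivation.holderExp_pos (s₀ := s₀) hv₀ s
  set α := IsAdmissibleActivation.holderExp s₀ v₀ 2
  set β := IsAdmissibleActivation.holderExp s₀ v₀ s
  set K' := K * 6 ^ (1 + 4 / α) with hK'
  have hK'0 : 0 ≤ K' := by positivity
  refine ⟨C + C * K' + 1, C₂, by positivity, hC₂, fun n hn A hA => ?_⟩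
  have hn1 : (1 : ℝ) ≤ n := by exact_mod_cast hn
  have hn0 : (0 : ℝ) < n := by linarith
  have hAn1 : 1 ≤ A * n := by nlinarith
  have hs' : (0 : ℝ) ≤ s := Nat.cast_nonneg s
  obtain ⟨η, hη⟩ : ∃ η : ℝ, η = (n : ℝ) ^ (-((s : ℝ) + v + 1)) := ⟨_, rfl⟩
  have hη0 : 0 < η := by rw [hη]; positivity
  have hη1 : η ≤ 1 := by
    rw [hη]
    exact Real.rpow_le_one_of_one_le_of_nonpos hn1 (by linarith)
  have hηp : ∀ p, η ^ (-p) = (n : ℝ) ^ (((s : ℝ) + v + 1) * p) := fun p => by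
    rw [hη, ← Real.rpow_mul hn0.le]
    congr 1
    ring
  obtain ⟨X, hX⟩ : ∃ X, X = coeffBound s s₀ v v₀ n A := ⟨_, rfl⟩
  have hX₁ : A * n * η ^ (-(1 + 4 / α)) ≤ X := by
    rw [hηp, hX]
    exact hcoeff n A _ hn hA (Or.inl le_rfl)
  have hX₂ : n * η ^ (-(2 / α)) ≤ X := by
    rw [hηp]
    refine le_trans ?_ ((hcoeff n A (((s : ℝ) + v + 1) * (2 / α)) hn hA (Or.inl ?_)).trans_eq
      hX.symm)
    · gcongr
      nlinarith
    · gcongr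
      have : 4 / α = 2 / α + 2 / α := by ring
      have : 0 < 2 / α := by positivity
      linarith
  have hX₃ : 1 * η ^ (-((s : ℝ) / β)) ≤ X := by
    rw [hηp]
    refine le_trans ?_ ((hcoeff n A (((s : ℝ) + v + 1) * (s / β)) hn hA (Or.inr le_rfl)).trans_eq
      hX.symm)
    gcongr
  have hX₄ : 1 ≤ X := by
    have : 1 ≤ η ^ (-((s : ℝ) / β)) := by
      rw [hηp]
      exact Real.one_le_rpow hn1 (by positivity)
    linarith
  -- The accuracy `η / 6` is the tolerance of the profile net; it explains the factor `6 ^ (1 + 4 /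
  -- α)` in `K'`.
  obtain ⟨a', b', w', ha', hb', hw', hτ⟩ := hsq (η / 6) (by positivity) (by linarith)
  obtain ⟨a, b, ω, θ, ha, hb, hω, hθ, hnet'⟩ := hnet n hn A hA η hη
  have hθ₀ : |θ₀| ≤ 1 + 3 * A * n + |θ₀| := by nlinarith
  have hCX : C * X ≤ (C + C * K' + 1) * X := by gcongr; nlinarith
  rw [← hX]
  refine ⟨{ a₃ := a, θ₃ := fun _ => θ₀, a₂ := b, θ₂ := θ
            a₁ := fun j i k => ω j i * a' k, θ₁ := fun _ _ _ => θ₀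
            a₀ := fun _ _ k _ => b' k, θ₀ := fun _ _ _ _ => θ₀, w := fun _ _ k _ => w' k },
    fun _ _ k _ => hw' k, ⟨fun _ => hθ₀, hθ, fun _ _ _ => hθ₀, fun _ _ _ _ => hθ₀⟩,
    ⟨fun x => ?_, fun x y => ?_, fun x y k => ?_, fun x y k l => ?_⟩, fun x hx => ?_⟩
  · exact (abs_le_mul_of_mul_rpow_le hη0 hC.le (ha x) hX₂).trans hCX
  · exact (abs_le_mul_of_mul_rpow_le hη0 hC.le ((hb x y).trans_eq (mul_one C).symm) hX₃).trans hCX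
  · have h1 : |a' k| * η ^ (1 + 4 / α) ≤ K' := by
      have := ha' k
      rw [Real.div_rpow hη0.le (by norm_num), ← mul_div_assoc, div_le_iff₀ (by positivity)] at this
      exact this
    have h2 : |ω x y * a' k| * η ^ (1 + 4 / α) ≤ C * K' * (A * n) := by
      rw [abs_mul, mul_assoc]
      calc _ ≤ C * (A * n) * K' := by gcongr; exact hω x y
        _ = _ := by ring
    refine (abs_le_mul_of_mul_rpow_le hη0 (by positivity) h2 hX₁).trans ?_
    gcongr
    linarith
  · refine (hb' k).trans ?_
    nlinarith [mul_nonneg hC.le hK'0]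
  · rw [TreeNet.eval_eq_biEval, hfg x hx]
    have hx1 : ‖x‖ ≤ 1 := by simpa using hx
    exact hnet' _ ⟨by positivity, pow_le_one₀ (norm_nonneg _) hx1⟩ _ (hτ x hx)
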